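/- Let $I=[\alpha,\beta]\subset\mathbb{R}$ with $\alpha<\beta$, and let $H\colon I\to\mathbb{C}^{N\times N}$ be a $C^\infty$ function with Hermitian values. Let $U(t,s)$, $t,s\in I$, be its propagator: $i\,\partial_t U(t,s)=H(t)U(t,s)$, $U(s,s)=\mathbb{1}$. Let $\|\cdot\|$ be the spectral norm. A product formula on $I$ is a finite ordered product $U_2(t,s)=\prod_l \exp\bigl(-i\,(t-s)\,G_l(s+\theta_l(t-s))\bigr)$ with each $G_l\colon I\to\mathbb{C}^{N\times N}$ smooth and Hermitian-valued and $\theta_l\in[0,1]$. It is symmetric if $U_2(t,s)^\dagger=U_2(s,t)$ for all $t,s\in I$. A map $V\colon I\times I\to\mathbb{C}^{N\times N}$ is an $n$-th order formula for $U$ if, for every $s\in I$, $\|V(t,s)-U(t,s)\|=O(|t-s|^{n+1})$ as $t\to s$ in $I$. Let $M\ge 1$, let $k_1,\dots,k_M$ be positive integers and let $a_1,\dots,a_M\in\mathbb{R}$ satisfy the Vandermonde system $\sum_j a_j=1$ and $\sum_j a_j k_j^{-2l}=0$ for $l=1,\dots,M-1$. For a base formula $U_2$ define the multiproduct formula $$U_{\vec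 k}(t,s)=\sum_{j=1}^M a_j\,U_2^{(k_j)}(t,s),\qquad U_2^{(k)}(t,s)=\prod_{q=1}^{k}U_2\Bigl(s+\tfrac{q}{k}(t-s),\,s+\tfrac{q-1}{k}(t-s)\Bigr),$$ where the product is time-ordered (latest time on the left). Theorem. The midpoint formula $\exp\bigl(-i\,(t-s)\,H(\tfrac{s+t}{2})\bigr)$ is a symmetric second-order product formula for $U$. For every symmetric second-order product formula $U_2$ for $U$, the multiproduct formula $U_{\vec k}$ built from $U_2$ is a $2M$-th order formula for $U$, that is, for every $t_0\in I$, $$\|U_{\vec k}(t,t_0)-U(t,t_0)\|=O(|t-t_0|^{2M+1})\qquad (t\to t_0,\ t\in I),$$ and it is unitary to one order better: for every $t_0\in I$, $$\|U_{\vec k}(t,t_0)^\dagger U_{\vec k}(t,t_0)-\mathbb{1}\|=O(|t-t_0|^{2M+2})\qquad (t\to t_0,\ t\in I).$$ -/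

import Mathlib

open scoped ContDiff Topology Matrix Matrix.Norms.L2Operator

namespace Multiproduct

variable {ι : Type*} [Fintype ι] [DecidableEq ι]

/-- `U t s` is the propagator (time evolution operator) from time `s` to time `t` generated by
`H` on the time interval `I`: for every initial time `s` in `I`, the function `t ↦ U t s` solves
`i ∂ₜ U(t, s) = H(t) U(t, s)`, `U(s, s) = 1`, on `I` (one-sided derivatives at end points). -/
def IsPropagator (I : Set ℝ) (H : ℝ → Matrix ι ι ℂ) (U : ℝ → ℝ → Matrix ι ι ℂ) : Prop :=
  ∀ s ∈ I, U s s = 1 ∧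
    ∀ t ∈ I, HasDerivWithinAt (fun τ => U τ s) (-Complex.I • (H t * U t s)) I t

/-- `V` is an `n`-th order formula for `U` on `I`: in the spectral norm,
`V(t, s) - U(t, s) = O((t - s)^(n + 1))` as `t → s` within `I`, for every initial time `s`. -/
def IsOrderFormula (n : ℕ) (I : Set ℝ) (U V : ℝ → ℝ → Matrix ι ι ℂ) : Prop :=
  ∀ s ∈ I, (fun t => ‖V t s - U t s‖) =O[𝓝[I] s] fun t => (t - s) ^ (n + 1)

/-- `V` is symmetric (under time reversal): `V(t, s)† = V(s, t)`. -/
def IsSymmetricFormula (I : Set ℝ) (V : ℝ → ℝ → Matrix ι ι ℂ) : Prop :=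
  ∀ t ∈ I, ∀ s ∈ I, (V t s)ᴴ = V s t

/-- The exponential `exp(-i G(s + θ (t - s)) (t - s))`. -/
noncomputable def stepExp (G : ℝ → Matrix ι ι ℂ) (θ t s : ℝ) : Matrix ι ι ℂ :=
  NormedSpace.exp ((-Complex.I * ((t - s : ℝ) : ℂ)) • G (s + θ * (t - s)))

/-- `V` is a product formula on `I`: a finite ordered product of exponentials
`exp(-i G(s + θ (t - s)) (t - s))`, where each `G` is a smooth Hermitian-valued function on `I`
(a term of the Hamiltonian, possibly rescaled) evaluated at an intermediate time,
`0 ≤ θ ≤ 1`. -/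
def IsProductFormula (I : Set ℝ) (V : ℝ → ℝ → Matrix ι ι ℂ) : Prop :=
  ∃ L : List ((ℝ → Matrix ι ι ℂ) × ℝ),
    (∀ p ∈ L, ContDiffOn ℝ ∞ p.1 I ∧ (∀ t ∈ I, (p.1 t).IsHermitian) ∧ p.2 ∈ Set.Icc (0 : ℝ) 1) ∧
    ∀ t ∈ I, ∀ s ∈ I, V t s = (L.map fun p => stepExp p.1 p.2 t s).prod

/-- The base formulas from which multiproduct formulas for `U` are built: symmetric second order
product formulas for `U`. -/
structure IsBaseFormula (I : Set ℝ) (U V : ℝ → ℝ → Matrix ι ι ℂ) : Prop where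
  isProductFormula : IsProductFormula I V
  isSymmetricFormula : IsSymmetricFormula I V
  isOrderFormula : IsOrderFormula 2 I U V

/-- The midpoint formula `U₂(t, s) = exp(-i H((s + t) / 2) (t - s))`. -/
noncomputable def midpointFormula (H : ℝ → Matrix ι ι ℂ) (t s : ℝ) : Matrix ι ι ℂ :=
  NormedSpace.exp ((-Complex.I * ((t - s : ℝ) : ℂ)) • H ((s + t) / 2))

/-- The `k`-step composition `V^(k)(t, s)`: the time-ordered product over `q = 1, …, k` (latest
time on the left) of `V(s + (t - s) q / k, s + (t - s) (q - 1) / k)`. -/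
noncomputable def iterate (V : ℝ → ℝ → Matrix ι ι ℂ) (k : ℕ) (t s : ℝ) : Matrix ι ι ℂ :=
  ((List.range k).map fun q : ℕ =>
    V (s + (t - s) * ((q + 1 : ℕ) : ℝ) / k) (s + (t - s) * (q : ℝ) / k)).reverse.prod

/-- The multiproduct formula `U_k(t, s) = ∑ⱼ aⱼ V^(kⱼ)(t, s)` with base formula `V`. -/
noncomputable def multiproduct {M : ℕ} (a : Fin M → ℝ) (k : Fin M → ℕ)
    (V : ℝ → ℝ → Matrix ι ι ℂ) (t s : ℝ) : Matrix ι ι ℂ :=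
  ∑ j, (a j : ℂ) • iterate V (k j) t s

/-- The Vandermonde system fixing the coefficients of a multiproduct formula with `M` terms:
`∑ⱼ aⱼ = 1` and `∑ⱼ aⱼ kⱼ^(-2l) = 0` for `l = 1, …, M - 1`. -/
def VandermondeSystem {M : ℕ} (a : Fin M → ℝ) (k : Fin M → ℕ) : Prop :=
  ∀ l < M, ∑ j, a j * ((k j : ℝ) ^ (2 * l))⁻¹ = if l = 0 then 1 else 0

end Multiproduct

/-!
By Taylor expansion of the generators at `s`, the step from `s + q δ` to `s + (q + 1) δ` of a
product formula has an asymptotic expansion in powers of `δ` whose coefficients are polynomials in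
`q`. Summation over `q` (Faulhaber) turns this into an expansion of the composition of `q` steps, in
which the coefficient of `δ ^ n` is a polynomial `g n` in `q` of degree at most `n`. The leading
coefficients of the `g n` satisfy the recursion of the exact evolution.

For a symmetric formula, reversing the time shows that `g n` is even or odd with `n`. Hence, with
`δ = (t - s) / k`, only even powers of `1 / k` occur in the expansion in `t - s`, and the
Vandermonde system cancels those with exponents `2, …, 2 M - 2`. Those with exponent at least `2 M`
first appear at order `2 M + 1`, as a real multiple of the derivative of `g (2 M + 1)` at `q = 0`.
This derivative is skew-adjoint, because the compositions are unitary for all `q`, so the leading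
error is tangent to the unitary group and does not affect unitarity at order `2 M + 1`.
-/

namespace Multiproduct

section MapCoeff

open Polynomial

variable {R S : Type*} [Semiring R] [Semiring S]

/-- The polynomial obtained by applying the additive map `φ i` to the coefficient of `X ^ i`. -/
noncomputable def mapCoeff (φ : ℕ → R →+ S) (p : R[X]) : S[X] :=
  p.sum fun i c => Polynomial.monomial i (φ i c)

@[simp]
lemma coeff_mapCoeff (φ : ℕ → R →+ S) (p : R[X]) (i : ℕ) :
    (mapCoeff φ p).coeff i = φ i (p.coeff i) := by
  simp +contextual [mapCoeff, Polynomial.sum_def, Polynomial.coeff_monomial]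

end MapCoeff

section Evaluation

open Polynomial PowerSeries Finset

variable {R : Type*} [Ring R] [Algebra ℝ R]

/-- Evaluation of a polynomial at a real number; the coefficients may lie in a noncommutative real
algebra, because real numbers are central there. -/
noncomputable def evalAt (x : ℝ) : R[X] →ₐ[ℝ] R :=
  Polynomial.eval₂AlgHom (AlgHom.id ℝ R) (algebraMap ℝ R x)
    fun a => (Algebra.commutes x a).symm

@[simp]
lemma evalAt_C (x : ℝ) (a : R) : evalAt x (Polynomial.C a) = a := by
  simp [evalAt, Polynomial.eval₂AlgHom]

@[simp]
lemma evalAt_X (x : ℝ) : evalAt x (Polynomial.X : R[X]) = algebraMap ℝ R x := by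
  simp [evalAt, Polynomial.eval₂AlgHom]

@[simp]
lemma evalAt_monomial (x : ℝ) (i : ℕ) (a : R) :
    evalAt x (Polynomial.monomial i a) = x ^ i • a := by
  rw [← Polynomial.C_mul_X_pow_eq_monomial, map_mul, map_pow, evalAt_C, evalAt_X, ← map_pow,
    ← Algebra.commutes, Algebra.smul_def]

lemma evalAt_eq_sum (x : ℝ) (p : R[X]) : evalAt x p = p.sum fun i c => x ^ i • c := by
  conv_lhs => rw [← p.sum_monomial_eq]
  simp only [Polynomial.sum_def, map_sum, evalAt_monomial]

lemma evalAt_eq_sum_range (x : ℝ) {p : R[X]} {n : ℕ} (hp : p.natDegree < n) :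
    evalAt x p = ∑ i ∈ range n, x ^ i • p.coeff i := by
  rw [evalAt_eq_sum, p.sum_over_range' (fun _ => smul_zero _) n hp]

lemma evalAt_trunc (x : ℝ) (n : ℕ) (P : R⟦X⟧) :
    evalAt x (P.trunc n) = ∑ i ∈ range n, x ^ i • PowerSeries.coeff i P := by
  rw [PowerSeries.trunc_apply, ← Finset.range_eq_Ico]
  simp only [map_sum, evalAt_monomial]

@[simp]
lemma evalAt_zero (p : R[X]) : evalAt 0 p = p.coeff 0 := by
  rw [evalAt_eq_sum_range 0 (Nat.lt_succ_self _), Finset.sum_range_succ']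
  simp

lemma evalAt_map_algebraMap (x : ℝ) (r : ℝ[X]) :
    evalAt x (r.map (algebraMap ℝ R)) = algebraMap ℝ R (r.eval x) := by
  induction r using Polynomial.induction_on' with
  | add p q hp hq => simp only [Polynomial.map_add, map_add, hp, hq, Polynomial.eval_add]
  | monomial n c =>
    rw [Polynomial.map_monomial, evalAt_monomial, Polynomial.eval_monomial, Algebra.smul_def,
      ← map_mul, mul_comm]

lemma evalAt_mapCoeff (φ : ℕ → R →+ R) (x : ℝ) (p : R[X]) :
    evalAt x (mapCoeff φ p) = p.sum fun i c => x ^ i • φ i c := by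
  simp only [mapCoeff, Polynomial.sum_def, map_sum, evalAt_monomial]

lemma eval_mapCoeff_dual (φ : Module.Dual ℝ R) (x : ℝ) (p : R[X]) :
    (mapCoeff (fun _ => φ.toAddMonoidHom) p).eval x = φ (evalAt x p) := by
  simp only [mapCoeff, evalAt_eq_sum, Polynomial.sum_def, Polynomial.eval_finsetSum,
    Polynomial.eval_monomial, LinearMap.toAddMonoidHom_coe, map_sum, map_smul, smul_eq_mul,
    mul_comm]

lemma eq_zero_of_forall_evalAt_natCast {p : R[X]} (hp : ∀ k : ℕ, evalAt (k : ℝ) p = 0) :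
    p = 0 := by
  ext i
  rw [Polynomial.coeff_zero, ← Module.forall_dual_apply_eq_zero_iff ℝ]
  intro φ
  have hφ : mapCoeff (fun _ => φ.toAddMonoidHom) p = 0 :=
    Polynomial.eq_zero_of_infinite_isRoot _
      (Set.infinite_of_injective_forall_mem (f := fun k : ℕ => (k : ℝ)) Nat.cast_injective
        fun k => by simp [Polynomial.IsRoot, eval_mapCoeff_dual, hp])
  simpa using congrArg (Polynomial.coeff · i) hφ

/-- Coefficientwise evaluation of a power series with polynomial coefficients. -/
noncomputable def evalSeries (x : ℝ) : R[X]⟦X⟧ →+* R⟦X⟧ :=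
  PowerSeries.map (evalAt x : R[X] →ₐ[ℝ] R).toRingHom

@[simp]
lemma coeff_evalSeries (x : ℝ) (F : R[X]⟦X⟧) (n : ℕ) :
    PowerSeries.coeff n (evalSeries x F) = evalAt x (PowerSeries.coeff n F) := by
  simp [evalSeries]

@[simp]
lemma evalSeries_X (x : ℝ) : evalSeries x (PowerSeries.X : R[X]⟦X⟧) = PowerSeries.X := by
  simp [evalSeries]

end Evaluation

section Scale

open PowerSeries Finset

variable {R : Type*} [Ring R] [Algebra ℝ R]

/-- The substitution `X ↦ c X` in a power series over a real algebra. (`PowerSeries.rescale` needs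
commuting coefficients.) -/
noncomputable def scale (c : ℝ) : R⟦X⟧ →+* R⟦X⟧ where
  toFun P := PowerSeries.mk fun n => c ^ n • coeff n P
  map_zero' := by ext; simp
  map_one' := by
    ext n
    by_cases h : n = 0 <;> simp [coeff_one, h]
  map_add' P Q := by ext; simp
  map_mul' P Q := by
    ext n
    simp only [coeff_mk, coeff_mul, Finset.smul_sum]
    refine Finset.sum_congr rfl fun x hx => ?_
    rw [smul_mul_smul_comm, ← pow_add, mem_antidiagonal.1 hx]

@[simp]
lemma coeff_scale (c : ℝ) (P : R⟦X⟧) (n : ℕ) : coeff n (scale c P) = c ^ n • coeff n P := by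
  simp [scale]

lemma scale_scale (c d : ℝ) (P : R⟦X⟧) : scale c (scale d P) = scale (c * d) P := by
  ext n
  simp only [coeff_scale, mul_pow, smul_smul]

lemma scale_X (c : ℝ) : scale c (X : R⟦X⟧) = c • X := by
  ext n
  by_cases h : n = 1 <;> simp [coeff_X, h]

end Scale

section Exponential

open PowerSeries Finset

variable {R : Type*} [Ring R] [Algebra ℝ R]

/-- The exponential of a power series without constant term. (With a constant term the defining
sum, in which only the powers `j ≤ n` contribute to the coefficient of `X ^ n`, is not the
exponential.) -/
noncomputable def expOf (Y : R⟦X⟧) : R⟦X⟧ :=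
  PowerSeries.mk fun n => ∑ j ∈ range (n + 1), ((j.factorial : ℝ)⁻¹) • coeff n (Y ^ j)

lemma coeff_expOf (Y : R⟦X⟧) (n : ℕ) :
    coeff n (expOf Y) = ∑ j ∈ range (n + 1), ((j.factorial : ℝ)⁻¹) • coeff n (Y ^ j) := by
  rw [expOf, coeff_mk]

@[simp]
lemma coeff_zero_expOf (Y : R⟦X⟧) : coeff 0 (expOf Y) = 1 := by
  simp [coeff_expOf]

lemma coeff_X_mul_pow_of_lt {S : Type*} [Semiring S] (Y : S⟦X⟧) {n j : ℕ} (h : n < j) :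
    coeff n ((X * Y) ^ j) = 0 := by
  rw [(commute_X Y).symm.mul_pow, coeff_X_pow_mul', if_neg (by omega)]

lemma evalSeries_expOf (x : ℝ) (Y : (Polynomial R)⟦X⟧) :
    evalSeries x (expOf Y) = expOf (evalSeries x Y) := by
  ext n
  simp only [coeff_evalSeries, coeff_expOf, map_sum, ← map_pow, map_smul]

lemma scale_expOf (c : ℝ) (Y : R⟦X⟧) : scale c (expOf Y) = expOf (scale c Y) := by
  ext n
  simp only [coeff_scale, coeff_expOf, ← map_pow, Finset.smul_sum, smul_comm (c ^ n)]

end Exponential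

section Expansion

open Asymptotics Filter Finset

variable {𝔸 : Type*} [NormedRing 𝔸] [NormedAlgebra ℝ 𝔸] {l : Filter ℝ}

lemma pow_isBigO_pow_of_le (hl : l ≤ 𝓝 0) {m n : ℕ} (h : n ≤ m) :
    (fun x : ℝ => x ^ m) =O[l] fun x => x ^ n := by
  have hbdd : (fun x : ℝ => x ^ (m - n)) =O[l] fun _ => (1 : ℝ) :=
    ((continuous_pow (m - n)).tendsto 0).mono_left hl |>.isBigO_one ℝ
  refine ((isBigO_refl (fun x : ℝ => x ^ n) l).mul hbdd).congr (fun x => ?_) fun x => mul_one _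
  rw [← pow_add, Nat.add_sub_cancel' h]

lemma pow_smul_isBigO (a : 𝔸) (n : ℕ) : (fun x : ℝ => x ^ n • a) =O[l] fun x => x ^ n :=
  IsBigO.of_bound ‖a‖ <| Eventually.of_forall fun x => by rw [norm_smul, mul_comm]

lemma evalAt_isBigO (hl : l ≤ 𝓝 0) {p : Polynomial 𝔸} {n : ℕ}
    (hp : ∀ i < n, p.coeff i = 0) : (fun x => evalAt x p) =O[l] fun x => x ^ n := by
  simp_rw [evalAt_eq_sum_range _ (Nat.lt_succ_self p.natDegree)]
  refine IsBigO.fun_sum fun i _ => ?_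
  rcases lt_or_ge i n with h | h
  · simpa only [hp i h, smul_zero] using isBigO_zero _ _
  · exact (pow_smul_isBigO _ _).trans (pow_isBigO_pow_of_le hl h)

lemma exp_sub_sum_isBigO [CompleteSpace 𝔸] {y : ℝ → 𝔸} (hl : l ≤ 𝓝 0)
    (hy : y =O[l] fun h => h) (n : ℕ) :
    (fun h => NormedSpace.exp (y h) - ∑ j ∈ range n, ((j.factorial : ℝ)⁻¹) • y h ^ j)
      =O[l] fun h => h ^ n := by
  have hexp := ((NormedSpace.exp_hasFPowerSeriesAt_zero (𝕂 := ℝ)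
    (𝔸 := 𝔸)).isBigO_sub_partialSum_pow n).comp_tendsto (hy.trans_tendsto hl)
  refine (hexp.congr_left fun h => ?_).trans (hy.norm_left.pow n)
  simp only [Function.comp_apply, zero_add, FormalMultilinearSeries.partialSum,
    NormedSpace.expSeries_apply_eq]

/-- The first `n` terms of the power series `P` approximate `f` up to `O(h ^ n)` as `h` tends to
`0` along the filter `l`. -/
def HasExpansionUpTo (n : ℕ) (l : Filter ℝ) (f : ℝ → 𝔸) (P : PowerSeries 𝔸) : Prop :=
  (fun h => f h - ∑ i ∈ range n, h ^ i • PowerSeries.coeff i P) =O[l] fun h => h ^ n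

/-- The (possibly divergent) power series `P` is the asymptotic expansion of `f` at `0` along the
filter `l`. -/
def HasExpansion (l : Filter ℝ) (f : ℝ → 𝔸) (P : PowerSeries 𝔸) : Prop :=
  ∀ n : ℕ, HasExpansionUpTo n l f P

variable {f g : ℝ → 𝔸} {P Q : PowerSeries 𝔸}

namespace HasExpansionUpTo

lemma isBigO_one {n : ℕ} (hl : l ≤ 𝓝 0) (hf : HasExpansionUpTo n l f P) :
    f =O[l] fun _ => (1 : ℝ) := by
  have htrunc : (fun x => evalAt x (P.trunc n)) =O[l] fun x => x ^ 0 :=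
    evalAt_isBigO hl fun i hi => absurd hi i.not_lt_zero
  have hrem := IsBigO.trans hf (pow_isBigO_pow_of_le hl n.zero_le)
  simpa only [evalAt_trunc, sub_add_cancel, pow_zero] using hrem.add htrunc

lemma mul {n : ℕ} (hl : l ≤ 𝓝 0) (hf : HasExpansionUpTo n l f P)
    (hg : HasExpansionUpTo n l g Q) : HasExpansionUpTo n l (fun h => f h * g h) (P * Q) := by
  have hfg := IsBigO.mul hf (hg.isBigO_one hl)
  have hPg := (evalAt_isBigO (n := 0) hl (p := P.trunc n) fun i hi =>
    absurd hi i.not_lt_zero).mul hg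
  have hPQ : (fun x => evalAt x (P.trunc n * Q.trunc n - (P * Q).trunc n)) =O[l]
      fun x => x ^ n := by
    refine evalAt_isBigO hl fun i hi => ?_
    rw [Polynomial.coeff_sub, PowerSeries.coeff_trunc, if_pos hi, Polynomial.coeff_mul,
      PowerSeries.coeff_mul, sub_eq_zero]
    refine Finset.sum_congr rfl fun x hx => ?_
    have := mem_antidiagonal.1 hx
    rw [PowerSeries.coeff_trunc, PowerSeries.coeff_trunc, if_pos (by omega), if_pos (by omega)]
  simp only [pow_zero, one_mul, mul_one] at hfg hPg
  refine ((hfg.add hPg).add hPQ).congr_left fun h => ?_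
  simp only [← evalAt_trunc, map_sub, map_mul]
  noncomm_ring

end HasExpansionUpTo

namespace HasExpansion

lemma congr (hf : HasExpansion l f P) (h : f =ᶠ[l] g) : HasExpansion l g P := fun n =>
  IsBigO.congr' (hf n) (h.mono fun x hx => by simp only [hx]) EventuallyEq.rfl

lemma zero : HasExpansion l (fun _ => (0 : 𝔸)) 0 := fun n => by
  simpa [HasExpansionUpTo] using isBigO_zero _ _

lemma one : HasExpansion l (fun _ => (1 : 𝔸)) 1 := by
  rintro (_ | n)
  · simpa [HasExpansionUpTo] using isBigO_const_const (1 : 𝔸) (one_ne_zero (α := ℝ)) l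
  · simpa [HasExpansionUpTo, sum_range_succ', PowerSeries.coeff_one] using isBigO_zero _ _

lemma add (hf : HasExpansion l f P) (hg : HasExpansion l g Q) :
    HasExpansion l (fun h => f h + g h) (P + Q) := fun n =>
  (IsBigO.add (hf n) (hg n)).congr_left fun h => by
    simp only [map_add, smul_add, sum_add_distrib]
    abel

lemma const_smul (c : ℝ) (hf : HasExpansion l f P) :
    HasExpansion l (fun h => c • f h) (c • P) := fun n =>
  (IsBigO.const_smul_left (hf n) c).congr_left fun h => by
    simp only [PowerSeries.coeff_smul, smul_sub, smul_sum, smul_comm c, Pi.smul_apply]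

lemma neg (hf : HasExpansion l f P) : HasExpansion l (fun h => -f h) (-P) := by
  simpa only [neg_one_smul] using hf.const_smul (-1)

lemma sub (hf : HasExpansion l f P) (hg : HasExpansion l g Q) :
    HasExpansion l (fun h => f h - g h) (P - Q) := by
  simpa only [sub_eq_add_neg] using hf.add hg.neg

lemma finset_sum {σ : Type*} {s : Finset σ} {f : σ → ℝ → 𝔸} {P : σ → PowerSeries 𝔸}
    (h : ∀ i ∈ s, HasExpansion l (f i) (P i)) :
    HasExpansion l (fun x => ∑ i ∈ s, f i x) (∑ i ∈ s, P i) := by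
  classical
  induction s using Finset.induction_on with
  | empty => simpa only [sum_empty] using zero
  | insert a s ha ih =>
    simp only [sum_insert ha]
    exact (h a (mem_insert_self _ _)).add (ih fun i hi => h i (mem_insert_of_mem hi))

lemma list_sum {σ : Type*} (L : List σ) {f : σ → ℝ → 𝔸} {P : σ → PowerSeries 𝔸}
    (h : ∀ i ∈ L, HasExpansion l (f i) (P i)) :
    HasExpansion l (fun x => (L.map fun i => f i x).sum) (L.map P).sum := by
  induction L with
  | nil => exact zero
  | cons a L ih =>
    simp only [List.map_cons, List.sum_cons]
    exact (h a List.mem_cons_self).add (ih fun i hi => h i (List.mem_cons_of_mem a hi))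

lemma mul (hl : l ≤ 𝓝 0) (hf : HasExpansion l f P) (hg : HasExpansion l g Q) :
    HasExpansion l (fun h => f h * g h) (P * Q) := fun n => (hf n).mul hl (hg n)

lemma pow (hl : l ≤ 𝓝 0) (hf : HasExpansion l f P) (n : ℕ) :
    HasExpansion l (fun h => f h ^ n) (P ^ n) := by
  induction n with
  | zero => simpa only [pow_zero] using one
  | succ n ih =>
    simp only [pow_succ]
    exact ih.mul hl hf

lemma list_prod (hl : l ≤ 𝓝 0) {σ : Type*} (L : List σ) {f : σ → ℝ → 𝔸}
    {P : σ → PowerSeries 𝔸} (h : ∀ i ∈ L, HasExpansion l (f i) (P i)) :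
    HasExpansion l (fun x => (L.map fun i => f i x).prod) (L.map P).prod := by
  induction L with
  | nil => exact one
  | cons a L ih =>
    simp only [List.map_cons, List.prod_cons]
    exact (h a List.mem_cons_self).mul hl (ih fun i hi => h i (List.mem_cons_of_mem a hi))

lemma id_smul (hl : l ≤ 𝓝 0) (hf : HasExpansion l f P) :
    HasExpansion l (fun h => h • f h) (PowerSeries.X * P) := by
  have hid : (fun h : ℝ => h) =O[l] fun h => h := isBigO_refl _ _
  rintro (_ | n)
  · have hbdd : (fun h : ℝ => h) =O[l] fun _ => (1 : ℝ) := by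
      simpa only [pow_one, pow_zero] using pow_isBigO_pow_of_le hl (Nat.zero_le 1)
    simpa [HasExpansionUpTo] using hbdd.smul ((hf 0).isBigO_one hl)
  · refine (hid.smul (hf n)).congr (fun h => ?_) fun h => by rw [pow_succ', smul_eq_mul]
    rw [sum_range_succ', smul_sub, smul_sum]
    simp [PowerSeries.coeff_succ_X_mul, pow_succ', smul_smul]

lemma comp_mul_left {c : ℝ} (hc : Tendsto (c * ·) l l) (hf : HasExpansion l f P) :
    HasExpansion l (fun h => f (c * h)) (scale c P) := by
  intro n
  have hpow : ((fun h : ℝ => h ^ n) ∘ fun h => c * h) =O[l] fun h => h ^ n :=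
    ((isBigO_refl (fun h : ℝ => h ^ n) l).const_mul_left (c ^ n)).congr_left fun h => by
      simp only [Function.comp_apply, mul_pow]
  refine ((IsBigO.comp_tendsto (hf n) hc).trans hpow).congr_left fun h => ?_
  simp only [Function.comp_apply, coeff_scale, mul_pow, smul_smul, mul_comm]

lemma exp [CompleteSpace 𝔸] (hl : l ≤ 𝓝 0) (hf : HasExpansion l f P) :
    HasExpansion l (fun h => NormedSpace.exp (h • f h)) (expOf (PowerSeries.X * P)) := by
  intro n
  have hX := hf.id_smul hl
  have hO : (fun h => h • f h) =O[l] fun h => h := by simpa [HasExpansionUpTo] using hX 1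
  have hpoly : HasExpansion l (fun h => ∑ j ∈ range n, ((j.factorial : ℝ)⁻¹) • (h • f h) ^ j)
      (∑ j ∈ range n, ((j.factorial : ℝ)⁻¹) • (PowerSeries.X * P) ^ j) :=
    finset_sum fun j _ => (hX.pow hl j).const_smul _
  have hcoeff : ∀ i ∈ range n, PowerSeries.coeff i (expOf (PowerSeries.X * P)) =
      PowerSeries.coeff i
        (∑ j ∈ range n, ((j.factorial : ℝ)⁻¹) • (PowerSeries.X * P) ^ j) := by
    intro i hi
    rw [mem_range] at hi
    simp only [coeff_expOf, map_sum, PowerSeries.coeff_smul]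
    refine Finset.sum_subset (range_subset_range.2 hi) fun j _ hj => ?_
    rw [mem_range, not_lt] at hj
    rw [coeff_X_mul_pow_of_lt P hj, smul_zero]
  refine ((exp_sub_sum_isBigO hl hO n).add (hpoly n)).congr_left fun h => ?_
  rw [Finset.sum_congr (s₁ := range n) rfl fun i hi => congrArg (h ^ i • ·) (hcoeff i hi)]
  abel

lemma isBigO_of_coeff_eq_zero (hf : HasExpansion l f P) {n : ℕ}
    (h : ∀ i < n, PowerSeries.coeff i P = 0) : f =O[l] fun h => h ^ n :=
  IsBigO.congr_left (hf n) fun x => by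
    rw [sum_eq_zero fun i hi => by rw [h i (mem_range.1 hi), smul_zero], sub_zero]

lemma isBigO_sub_of_coeff_eq_zero (hf : HasExpansion l f P) {n : ℕ}
    (h : ∀ i < n, PowerSeries.coeff i P = 0) :
    (fun h => f h - h ^ n • PowerSeries.coeff n P) =O[l] fun h => h ^ (n + 1) :=
  IsBigO.congr_left (hf (n + 1)) fun x => by
    rw [sum_range_succ, sum_eq_zero fun i hi => by rw [h i (mem_range.1 hi), smul_zero], zero_add]

lemma coeff_eq_zero [(l ⊓ 𝓟 {0}ᶜ).NeBot] (hl : l ≤ 𝓝 0) (hf : HasExpansion l f P) {n : ℕ}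
    (hO : f =O[l] fun h => h ^ n) : ∀ i < n, PowerSeries.coeff i P = 0 := by
  intro i
  induction i using Nat.strong_induction_on with
  | _ i ih =>
  intro hi
  have hterm : (fun h : ℝ => h ^ i • PowerSeries.coeff i P) =O[l] fun h => h ^ (i + 1) :=
    ((hO.trans (pow_isBigO_pow_of_le hl hi)).sub
      (hf.isBigO_sub_of_coeff_eq_zero fun j hj => ih j hj (hj.trans hi))).congr_left
      fun h => sub_sub_cancel _ _
  have hconst : (fun _ : ℝ => PowerSeries.coeff i P) =O[l ⊓ 𝓟 {0}ᶜ] fun h => h := by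
    obtain ⟨c, hc⟩ := hterm.bound
    refine IsBigO.of_bound c ?_
    filter_upwards [hc.filter_mono inf_le_left, mem_inf_of_right (mem_principal_self _)]
      with h hh h0
    have hpos : 0 < ‖h ^ i‖ := norm_pos_iff.2 (pow_ne_zero i h0)
    rw [norm_smul, pow_succ, norm_mul] at hh
    exact le_of_mul_le_mul_left (by linarith) hpos
  exact tendsto_nhds_unique tendsto_const_nhds (hconst.trans_tendsto (inf_le_left.trans hl))

lemma coeff_eq [(l ⊓ 𝓟 {0}ᶜ).NeBot] (hl : l ≤ 𝓝 0) (hf : HasExpansion l f P)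
    (hg : HasExpansion l g Q) {n : ℕ} (hO : (fun h => f h - g h) =O[l] fun h => h ^ n) :
    ∀ i < n, PowerSeries.coeff i P = PowerSeries.coeff i Q := fun i hi => by
  simpa only [map_sub, sub_eq_zero] using (hf.sub hg).coeff_eq_zero hl hO i hi

lemma unique [(l ⊓ 𝓟 {0}ᶜ).NeBot] (hl : l ≤ 𝓝 0) (hf : HasExpansion l f P)
    (hg : HasExpansion l f Q) : P = Q := by
  ext i
  refine hf.coeff_eq hl hg (n := i + 1) ?_ i (Nat.lt_succ_self i)
  simpa only [sub_self] using isBigO_zero _ _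

end HasExpansion

end Expansion

section StarSeries

variable {R : Type*} [Semiring R] [StarRing R]

/-- The coefficientwise adjoint of a power series. -/
noncomputable def starSeries (P : PowerSeries R) : PowerSeries R :=
  PowerSeries.mk fun n => star (PowerSeries.coeff n P)

@[simp]
lemma coeff_starSeries (P : PowerSeries R) (n : ℕ) :
    PowerSeries.coeff n (starSeries P) = star (PowerSeries.coeff n P) := by
  rw [starSeries, PowerSeries.coeff_mk]

lemma HasExpansion.star {𝔸 : Type*} [NormedRing 𝔸] [NormedAlgebra ℝ 𝔸] [StarRing 𝔸]
    [NormedStarGroup 𝔸] [StarModule ℝ 𝔸] {l : Filter ℝ} {f : ℝ → 𝔸} {P : PowerSeries 𝔸}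
    (hf : HasExpansion l f P) : HasExpansion l (fun h => star (f h)) (starSeries P) := fun n => by
  refine Asymptotics.IsBigO.of_norm_left
    ((Asymptotics.IsBigO.norm_left (hf n)).congr_left fun h => ?_)
  rw [← norm_star]
  simp only [star_sub, star_sum, star_smul, star_trivial, coeff_starSeries]

end StarSeries

section Graded

open Polynomial PowerSeries Finset

variable {R : Type*} [Ring R]

/-- The coefficient of `X ^ n` in `F` is a polynomial of degree at most `n - 1`, as for the
expansion of a step of a product formula in the step size, whose coefficients are polynomials in
the number of the step. (For `n = 0` the truncated subtraction requires a constant.) -/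
def IsGraded (F : R[X]⟦X⟧) : Prop := ∀ n, (PowerSeries.coeff n F).natDegree ≤ n - 1

/-- The series formed by the coefficients of the highest degree allowed in a graded series. -/
noncomputable def topSeries (F : R[X]⟦X⟧) : R⟦X⟧ :=
  PowerSeries.mk fun n => (PowerSeries.coeff (n + 1) F).coeff n

@[simp]
lemma coeff_topSeries (F : R[X]⟦X⟧) (n : ℕ) :
    PowerSeries.coeff n (topSeries F) = (PowerSeries.coeff (n + 1) F).coeff n := by
  rw [topSeries, PowerSeries.coeff_mk]

namespace IsGraded

variable {F G : R[X]⟦X⟧}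

lemma one : IsGraded (1 : R[X]⟦X⟧) := fun n => by
  rw [PowerSeries.coeff_one]
  split_ifs <;> simp

lemma mul (hF : IsGraded F) (hG : IsGraded G) : IsGraded (F * G) := fun n => by
  rw [PowerSeries.coeff_mul]
  refine Polynomial.natDegree_sum_le_of_forall_le _ _ fun x hx => ?_
  have hx := mem_antidiagonal.1 hx
  have hFx := hF x.1
  have hGx := hG x.2
  exact Polynomial.natDegree_mul_le.trans (by omega)

lemma pow (hF : IsGraded F) (n : ℕ) : IsGraded (F ^ n) := by
  induction n with
  | zero => simpa only [pow_zero] using one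
  | succ n ih => exact pow_succ F n ▸ ih.mul hF

lemma list_prod (L : List R[X]⟦X⟧) (h : ∀ F ∈ L, IsGraded F) : IsGraded L.prod := by
  induction L with
  | nil => exact one
  | cons F L ih =>
    rw [List.prod_cons]
    exact (h F List.mem_cons_self).mul (ih fun G hG => h G (List.mem_cons_of_mem F hG))

lemma coeff_mul_coeff_eq_zero (hF : IsGraded F) (hG : IsGraded G) {i j n : ℕ} (hi : 0 < i)
    (hj : 0 < j) (hij : i + j = n + 1) :
    (PowerSeries.coeff i F * PowerSeries.coeff j G).coeff n = 0 := by
  have hFi := hF i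
  have hGj := hG j
  exact Polynomial.coeff_eq_zero_of_natDegree_lt
    (Polynomial.natDegree_mul_le.trans_lt (by omega))

lemma topSeries_mul (hF : IsGraded F) (hG : IsGraded G) :
    topSeries (F * G) = PowerSeries.C ((PowerSeries.coeff 0 F).coeff 0) * topSeries G
      + topSeries F * PowerSeries.C ((PowerSeries.coeff 0 G).coeff 0) := by
  ext n
  have hleft := Polynomial.coeff_mul_add_eq_of_natDegree_le (hF 0) (hG (n + 1))
  have hright := Polynomial.coeff_mul_add_eq_of_natDegree_le (hF (n + 1)) (hG 0)
  simp only [Nat.zero_sub, zero_add, add_zero, Nat.add_sub_cancel] at hleft hright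
  rw [map_add, PowerSeries.coeff_C_mul, PowerSeries.coeff_mul_C, coeff_topSeries, coeff_topSeries,
    coeff_topSeries, PowerSeries.coeff_mul, Polynomial.finsetSum_coeff, ← hleft, ← hright]
  refine Finset.sum_eq_add (0, n + 1) (n + 1, 0) (by simp) (fun x hx hne => ?_) (by simp) (by simp)
  have hx := mem_antidiagonal.1 hx
  simp only [ne_eq, Prod.ext_iff] at hne
  exact hF.coeff_mul_coeff_eq_zero hG (by omega) (by omega) hx

variable [Algebra ℝ R]

lemma expOf (hF : IsGraded F) : IsGraded (Multiproduct.expOf F) := fun n => by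
  rw [coeff_expOf]
  exact Polynomial.natDegree_sum_le_of_forall_le _ _ fun j _ =>
    (Polynomial.natDegree_smul_le _ _).trans (hF.pow j n)

lemma topSeries_expOf (hF : IsGraded F) (hF0 : PowerSeries.coeff 0 F = 0) :
    topSeries (Multiproduct.expOf F) = topSeries F := by
  have hpow : ∀ j, topSeries (F ^ (j + 2)) = 0 := fun j => by
    have hpow0 : PowerSeries.coeff 0 (F ^ (j + 1)) = 0 := by
      rw [PowerSeries.coeff_zero_eq_constantCoeff_apply] at hF0 ⊢
      rw [map_pow, hF0, zero_pow j.succ_ne_zero]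
    rw [pow_succ, (hF.pow (j + 1)).topSeries_mul hF, hpow0, hF0]
    simp
  ext n
  rw [coeff_topSeries, coeff_expOf, Polynomial.finsetSum_coeff,
    Finset.sum_eq_single_of_mem 1 (by simp)]
  · simp
  · rintro (_ | _ | j) _ hj
    · simp [PowerSeries.coeff_one]
    · exact absurd rfl hj
    · rw [Polynomial.coeff_smul, ← coeff_topSeries, hpow, map_zero, smul_zero]

end IsGraded

lemma natDegree_X_add_C_pow_le (c : R) (n : ℕ) :
    ((Polynomial.X + Polynomial.C c) ^ n).natDegree ≤ n := by
  refine Polynomial.natDegree_le_iff_coeff_eq_zero.2 fun m hm => ?_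
  rw [Polynomial.coeff_X_add_C_pow, Nat.choose_eq_zero_of_lt hm, Nat.cast_zero, mul_zero]

variable [Algebra ℝ R]

/-- The power series in the step size `X`, with polynomials in `q` as coefficients, that represents
`a((q + θ) X)`. -/
noncomputable def affineSeries (a : R⟦X⟧) (θ : ℝ) : R[X]⟦X⟧ :=
  PowerSeries.mk fun n => Polynomial.C (PowerSeries.coeff n a)
    * (Polynomial.X + Polynomial.C (algebraMap ℝ R θ)) ^ n

/-- The power series that represents `exp(X a((q + θ) X))`, an exponential of a product formula in
the step number `q` of a composition with step size `X`. -/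
noncomputable def factorSeries (a : R⟦X⟧) (θ : ℝ) : R[X]⟦X⟧ :=
  expOf (PowerSeries.X * affineSeries a θ)

/-- The power series that represents the step number `q` of the composition of a product formula
with step size `X`. -/
noncomputable def stepSeries (L : List (R⟦X⟧ × ℝ)) : R[X]⟦X⟧ :=
  (L.map fun p => factorSeries p.1 p.2).prod

lemma isGraded_X_mul_affineSeries (a : R⟦X⟧) (θ : ℝ) :
    IsGraded (PowerSeries.X * affineSeries a θ) := by
  rintro (_ | n)
  · simp
  · rw [PowerSeries.coeff_succ_X_mul, affineSeries, PowerSeries.coeff_mk]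
    exact (Polynomial.natDegree_C_mul_le _ _).trans (natDegree_X_add_C_pow_le _ _)

lemma isGraded_factorSeries (a : R⟦X⟧) (θ : ℝ) : IsGraded (factorSeries a θ) :=
  (isGraded_X_mul_affineSeries a θ).expOf

lemma isGraded_stepSeries (L : List (R⟦X⟧ × ℝ)) : IsGraded (stepSeries L) :=
  IsGraded.list_prod _ (List.forall_mem_map.2 fun p _ => isGraded_factorSeries p.1 p.2)

lemma coeff_zero_stepSeries (L : List (R⟦X⟧ × ℝ)) :
    PowerSeries.coeff 0 (stepSeries L) = 1 := by
  rw [stepSeries, PowerSeries.coeff_zero_eq_constantCoeff_apply, map_list_prod, List.map_map]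
  refine List.prod_eq_one (List.forall_mem_map.2 fun p _ => ?_)
  rw [Function.comp_apply, ← PowerSeries.coeff_zero_eq_constantCoeff_apply, factorSeries,
    coeff_zero_expOf]

lemma topSeries_X_mul_affineSeries (a : R⟦X⟧) (θ : ℝ) :
    topSeries (PowerSeries.X * affineSeries a θ) = a := by
  ext n
  rw [coeff_topSeries, PowerSeries.coeff_succ_X_mul, affineSeries, PowerSeries.coeff_mk,
    Polynomial.coeff_C_mul, Polynomial.coeff_X_add_C_pow]
  simp

lemma topSeries_factorSeries (a : R⟦X⟧) (θ : ℝ) : topSeries (factorSeries a θ) = a := by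
  rw [factorSeries, (isGraded_X_mul_affineSeries a θ).topSeries_expOf (by simp),
    topSeries_X_mul_affineSeries]

lemma topSeries_stepSeries (L : List (R⟦X⟧ × ℝ)) :
    topSeries (stepSeries L) = (L.map Prod.fst).sum := by
  induction L with
  | nil =>
    ext n
    simp [stepSeries, PowerSeries.coeff_one]
  | cons p L ih =>
    have hcons : stepSeries (p :: L) = factorSeries p.1 p.2 * stepSeries L := List.prod_cons
    rw [hcons, (isGraded_factorSeries _ _).topSeries_mul (isGraded_stepSeries L), ih,
      coeff_zero_stepSeries, topSeries_factorSeries, factorSeries, coeff_zero_expOf,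
      Polynomial.coeff_one_zero, map_one, one_mul, mul_one, List.map_cons, List.sum_cons, add_comm]

lemma evalSeries_affineSeries (a : R⟦X⟧) (θ q : ℝ) :
    evalSeries q (affineSeries a θ) = scale (q + θ) a := by
  ext n
  simp only [coeff_evalSeries, affineSeries, PowerSeries.coeff_mk, coeff_scale, map_mul, map_pow,
    map_add, evalAt_C, evalAt_X]
  rw [← map_add, ← map_pow, ← Algebra.commutes, Algebra.smul_def]

lemma evalSeries_stepSeries (L : List (R⟦X⟧ × ℝ)) (q : ℝ) :
    evalSeries q (stepSeries L)
      = (L.map fun p => expOf (PowerSeries.X * scale (q + p.2) p.1)).prod := by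
  rw [stepSeries, map_list_prod, List.map_map]
  refine congrArg List.prod (List.map_congr_left fun p _ => ?_)
  rw [Function.comp_apply, factorSeries, evalSeries_expOf, map_mul, evalSeries_X,
    evalSeries_affineSeries]

end Graded

section Antidifference

open Polynomial

/-- The polynomial `s` with `s(x + 1) - s(x) = x ^ r` and `s(0) = 0`, so that `s(k)` is the sum of
the `r`-th powers of `0, …, k - 1` (Faulhaber's formula). -/
noncomputable def faulhaber (r : ℕ) : ℝ[X] :=
  ((r : ℝ) + 1)⁻¹ • ((Polynomial.bernoulli (r + 1)).map (algebraMap ℚ ℝ)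
    - C (_root_.bernoulli (r + 1) : ℝ))

lemma natDegree_faulhaber_le (r : ℕ) : (faulhaber r).natDegree ≤ r + 1 := by
  refine (Polynomial.natDegree_smul_le _ _).trans ?_
  rw [Polynomial.natDegree_sub_C]
  refine Polynomial.natDegree_map_le.trans (Polynomial.natDegree_le_iff_coeff_eq_zero.2 ?_)
  intro n hn
  rw [Polynomial.coeff_bernoulli, if_neg (by omega)]

lemma coeff_faulhaber_succ (r : ℕ) : (faulhaber r).coeff (r + 1) = ((r : ℝ) + 1)⁻¹ := by
  simp [faulhaber, Polynomial.coeff_bernoulli, Polynomial.coeff_C_succ]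

@[simp]
lemma eval_zero_faulhaber (r : ℕ) : (faulhaber r).eval 0 = 0 := by
  have hzero : ((Polynomial.bernoulli (r + 1)).map (algebraMap ℚ ℝ)).eval 0 =
      (_root_.bernoulli (r + 1) : ℝ) := by
    rw [Polynomial.eval_zero_map, Polynomial.bernoulli_eval_zero, eq_ratCast]
  rw [faulhaber, Polynomial.eval_smul, Polynomial.eval_sub, Polynomial.eval_C, hzero, sub_self,
    smul_zero]

lemma eval_add_one_faulhaber (r : ℕ) (x : ℝ) :
    (faulhaber r).eval (x + 1) = (faulhaber r).eval x + x ^ r := by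
  have hstep : ((Polynomial.bernoulli (r + 1)).map (algebraMap ℚ ℝ)).eval (x + 1) =
      ((Polynomial.bernoulli (r + 1)).map (algebraMap ℚ ℝ)).eval x + ((r : ℝ) + 1) * x ^ r := by
    have hcomp := congrArg (fun p => (p.map (algebraMap ℚ ℝ)).eval x)
      (Polynomial.bernoulli_comp_one_add_X (r + 1))
    simpa [Polynomial.map_comp, add_comm] using hcomp
  have hr : (r : ℝ) + 1 ≠ 0 := by positivity
  simp only [faulhaber, Polynomial.eval_smul, Polynomial.eval_sub, Polynomial.eval_C, hstep,
    smul_eq_mul]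
  field_simp
  ring

variable {R : Type*} [Ring R] [Algebra ℝ R]

/-- The polynomial `q` with `q(x + 1) - q(x) = p(x)` and `q(0) = 0`. -/
noncomputable def antidifference (p : R[X]) : R[X] :=
  p.sum fun r c => (faulhaber r).map (algebraMap ℝ R) * C c

lemma evalAt_antidifference (x : ℝ) (p : R[X]) :
    evalAt x (antidifference p) = p.sum fun r c => (faulhaber r).eval x • c := by
  simp only [antidifference, Polynomial.sum_def, map_sum, map_mul, evalAt_C, evalAt_map_algebraMap,
    Algebra.smul_def]

@[simp]
lemma evalAt_zero_antidifference (p : R[X]) : evalAt 0 (antidifference p) = 0 := by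
  simp [evalAt_antidifference, Polynomial.sum_def]

lemma evalAt_add_one_antidifference (p : R[X]) (x : ℝ) :
    evalAt (x + 1) (antidifference p) = evalAt x (antidifference p) + evalAt x p := by
  rw [evalAt_antidifference, evalAt_antidifference, evalAt_eq_sum]
  simp only [eval_add_one_faulhaber, add_smul, Polynomial.sum_def, Finset.sum_add_distrib]

lemma natDegree_antidifference_le {p : R[X]} {n : ℕ} (h : p.natDegree ≤ n) :
    (antidifference p).natDegree ≤ n + 1 :=
  Polynomial.natDegree_sum_le_of_forall_le _ _ fun r hr =>
    (Polynomial.natDegree_mul_C_le _ _).trans <| Polynomial.natDegree_map_le.trans <|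
      (natDegree_faulhaber_le r).trans <|
        Nat.succ_le_succ ((Polynomial.le_natDegree_of_mem_supp r hr).trans h)

lemma succ_smul_coeff_succ_antidifference {p : R[X]} {n : ℕ} (h : p.natDegree ≤ n) :
    ((n : ℝ) + 1) • (antidifference p).coeff (n + 1) = p.coeff n := by
  have hn : (n : ℝ) + 1 ≠ 0 := by positivity
  rw [antidifference, Polynomial.sum_over_range' _ (by simp) (n + 1) (by omega),
    Finset.sum_range_succ, Polynomial.coeff_add, Polynomial.finsetSum_coeff,
    Finset.sum_eq_zero fun r hr => ?_, zero_add, Polynomial.coeff_mul_C, Polynomial.coeff_map,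
    coeff_faulhaber_succ, ← Algebra.smul_def, smul_smul, mul_inv_cancel₀ hn, one_smul]
  rw [Polynomial.coeff_mul_C, Polynomial.coeff_map, Polynomial.coeff_eq_zero_of_natDegree_lt,
    map_zero, zero_mul]
  exact (natDegree_faulhaber_le r).trans_lt (Nat.succ_lt_succ (Finset.mem_range.1 hr))

end Antidifference

section Global

open Polynomial PowerSeries Finset

variable {R : Type*} [Ring R]

/-- The series formed by the coefficients of `q ^ n X ^ n` in a series in `X` with polynomials in
`q` as coefficients: the limit of `G(q, h / q)` as `q → ∞` if the coefficient of `X ^ n` in `G` has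
degree at most `n`. -/
noncomputable def diagonalSeries (G : R[X]⟦X⟧) : R⟦X⟧ :=
  PowerSeries.mk fun n => (PowerSeries.coeff n G).coeff n

@[simp]
lemma coeff_diagonalSeries (G : R[X]⟦X⟧) (n : ℕ) :
    PowerSeries.coeff n (diagonalSeries G) = (PowerSeries.coeff n G).coeff n := by
  rw [diagonalSeries, PowerSeries.coeff_mk]

variable [Algebra ℝ R]

/-- The coefficients of the solution of `G(q + 1) = F(q) G(q)`, `G(0) = 1`, for `F` with constant
coefficient `1`, obtained by recursive summation over `q`. -/
noncomputable def globalCoeff (F : R[X]⟦X⟧) : ℕ → R[X]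
  | 0 => 1
  | n + 1 => antidifference
      (∑ m : Fin (n + 1), PowerSeries.coeff (n + 1 - m) F * globalCoeff F m)

/-- If `F` represents the step number `q` of a one-step method, `globalSeries F` represents the
composition of the first `q` steps. -/
noncomputable def globalSeries (F : R[X]⟦X⟧) : R[X]⟦X⟧ := PowerSeries.mk (globalCoeff F)

variable (F : R[X]⟦X⟧)

lemma coeff_zero_globalSeries : PowerSeries.coeff 0 (globalSeries F) = 1 := by
  rw [globalSeries, PowerSeries.coeff_mk, globalCoeff]

lemma coeff_succ_globalSeries (n : ℕ) :
    PowerSeries.coeff (n + 1) (globalSeries F) = antidifference (∑ x ∈ antidiagonal n,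
      PowerSeries.coeff (x.1 + 1) F * PowerSeries.coeff x.2 (globalSeries F)) := by
  rw [globalSeries, PowerSeries.coeff_mk, globalCoeff, ← Finset.Nat.sum_antidiagonal_swap,
    Finset.Nat.sum_antidiagonal_eq_sum_range_succ_mk, Finset.sum_range]
  refine congrArg antidifference (Finset.sum_congr rfl fun m _ => ?_)
  rw [Prod.swap_prod_mk, PowerSeries.coeff_mk, Nat.sub_add_comm (Nat.le_of_lt_succ m.2)]

lemma evalSeries_zero_globalSeries : evalSeries 0 (globalSeries F) = 1 := by
  ext n
  rw [coeff_evalSeries, PowerSeries.coeff_one]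
  cases n with
  | zero => rw [coeff_zero_globalSeries, map_one, if_pos rfl]
  | succ n => rw [coeff_succ_globalSeries, evalAt_zero_antidifference, if_neg n.succ_ne_zero]

variable {F}

lemma evalSeries_add_one_globalSeries (hF : PowerSeries.coeff 0 F = 1) (x : ℝ) :
    evalSeries (x + 1) (globalSeries F) = evalSeries x F * evalSeries x (globalSeries F) := by
  rw [← map_mul]
  ext n
  rw [coeff_evalSeries, coeff_evalSeries, PowerSeries.coeff_mul]
  cases n with
  | zero => simp [coeff_zero_globalSeries, hF]
  | succ n =>
    rw [Finset.Nat.sum_antidiagonal_succ, hF, one_mul, coeff_succ_globalSeries,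
      evalAt_add_one_antidifference, map_add]

lemma natDegree_coeff_globalSeries_le (hF : IsGraded F) (n : ℕ) :
    (PowerSeries.coeff n (globalSeries F)).natDegree ≤ n := by
  induction n using Nat.strong_induction_on with
  | _ n ih =>
  cases n with
  | zero => simp [coeff_zero_globalSeries]
  | succ n =>
    rw [coeff_succ_globalSeries]
    refine natDegree_antidifference_le ?_
    refine Polynomial.natDegree_sum_le_of_forall_le _ _ fun x hx => ?_
    have hx := mem_antidiagonal.1 hx
    have hFx := hF (x.1 + 1)
    have hGx := ih x.2 (by omega)
    exact Polynomial.natDegree_mul_le.trans (by omega)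

/-- Compositions with vanishing step size solve the linear differential equation whose coefficient
is the generator of the step. -/
lemma succ_smul_coeff_succ_diagonalSeries (hF : IsGraded F) (n : ℕ) :
    ((n : ℝ) + 1) • PowerSeries.coeff (n + 1) (diagonalSeries (globalSeries F))
      = PowerSeries.coeff n (topSeries F * diagonalSeries (globalSeries F)) := by
  have hdeg : ∀ x ∈ antidiagonal n, (PowerSeries.coeff (x.1 + 1) F).natDegree ≤ x.1 ∧
      (PowerSeries.coeff x.2 (globalSeries F)).natDegree ≤ x.2 := fun x _ =>
    ⟨hF (x.1 + 1), natDegree_coeff_globalSeries_le hF x.2⟩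
  rw [coeff_diagonalSeries, coeff_succ_globalSeries, succ_smul_coeff_succ_antidifference,
    Polynomial.finsetSum_coeff, PowerSeries.coeff_mul]
  · refine Finset.sum_congr rfl fun x hx => ?_
    rw [coeff_topSeries, coeff_diagonalSeries,
      ← Polynomial.coeff_mul_add_eq_of_natDegree_le (hdeg x hx).1 (hdeg x hx).2,
      mem_antidiagonal.1 hx]
  · refine Polynomial.natDegree_sum_le_of_forall_le _ _ fun x hx => ?_
    exact (Polynomial.natDegree_mul_le_of_le (hdeg x hx).1 (hdeg x hx).2).trans_eq
      (mem_antidiagonal.1 hx)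

/-- Time reversal is the substitution `(q, X) ↦ (-q, -X)`. -/
lemma scale_neg_one_evalSeries_neg_globalSeries (hF0 : PowerSeries.coeff 0 F = 1)
    (hF : ∀ q : ℕ, evalSeries (q : ℝ) F * scale (-1) (evalSeries (-((q : ℝ) + 1)) F) = 1)
    (k : ℕ) :
    scale (-1) (evalSeries (-(k : ℝ)) (globalSeries F)) = evalSeries (k : ℝ) (globalSeries F) := by
  induction k with
  | zero => rw [Nat.cast_zero, neg_zero, evalSeries_zero_globalSeries, map_one]
  | succ k ih =>
    have hstep := evalSeries_add_one_globalSeries hF0 (-((k : ℝ) + 1))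
    rw [neg_add_rev, neg_add_cancel_comm] at hstep
    rw [hstep, map_mul, ← neg_add_rev] at ih
    rw [Nat.cast_succ, evalSeries_add_one_globalSeries hF0, ← ih, ← mul_assoc, hF, one_mul]

lemma coeff_coeff_eq_zero_of_odd {G : R[X]⟦X⟧}
    (hG : ∀ k : ℕ, scale (-1) (evalSeries (-(k : ℝ)) G) = evalSeries (k : ℝ) G) {n i : ℕ}
    (h : Odd (n + i)) : (PowerSeries.coeff n G).coeff i = 0 := by
  set g := PowerSeries.coeff n G with hg
  have hzero : mapCoeff (fun j => DistribSMul.toAddMonoidHom R ((-1 : ℝ) ^ (n + j))) g - g = 0 := by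
    refine eq_zero_of_forall_evalAt_natCast fun k => ?_
    have hk := congrArg (PowerSeries.coeff n) (hG k)
    rw [coeff_scale, coeff_evalSeries, coeff_evalSeries, ← hg, evalAt_eq_sum,
      Polynomial.sum_def, smul_sum] at hk
    rw [map_sub, ← hk, evalAt_mapCoeff, Polynomial.sum_def, sub_eq_zero]
    refine Finset.sum_congr rfl fun j _ => ?_
    rw [DistribSMul.toAddMonoidHom_apply, smul_smul, smul_smul, neg_pow (k : ℝ), pow_add]
    ring_nf
  have hi := congrArg (Polynomial.coeff · i) hzero
  simp only [Polynomial.coeff_sub, coeff_mapCoeff, DistribSMul.toAddMonoidHom_apply,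
    h.neg_one_pow, neg_one_smul, Polynomial.coeff_zero] at hi
  have htwo : (2 : ℝ) • g.coeff i = 0 := by rw [two_smul, ← neg_eq_zero, neg_add', hi]
  exact (smul_eq_zero.1 htwo).resolve_left two_ne_zero

end Global

section Unitarity

open Polynomial PowerSeries Finset

variable {R : Type*} [Ring R]

/-- The series formed by the coefficients of `q` in a series with polynomials in `q` as
coefficients, that is, its derivative with respect to `q` at `0`. -/
noncomputable def linearSeries (G : R[X]⟦X⟧) : R⟦X⟧ :=
  PowerSeries.mk fun n => (PowerSeries.coeff n G).coeff 1

@[simp]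
lemma coeff_linearSeries (G : R[X]⟦X⟧) (n : ℕ) :
    PowerSeries.coeff n (linearSeries G) = (PowerSeries.coeff n G).coeff 1 := by
  rw [linearSeries, PowerSeries.coeff_mk]

@[simp]
lemma linearSeries_one : linearSeries (1 : R[X]⟦X⟧) = 0 := by
  ext n
  rw [coeff_linearSeries, PowerSeries.coeff_one]
  split_ifs <;> simp [Polynomial.coeff_one]

/-- The adjoint of a series with polynomials in a real variable as coefficients. -/
noncomputable def starPolynomialSeries [StarRing R] (G : R[X]⟦X⟧) : R[X]⟦X⟧ :=
  PowerSeries.mk fun n =>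
    mapCoeff (fun _ => (starAddEquiv : R ≃+ R).toAddMonoidHom) (PowerSeries.coeff n G)

lemma linearSeries_starPolynomialSeries [StarRing R] (G : R[X]⟦X⟧) :
    linearSeries (starPolynomialSeries G) = starSeries (linearSeries G) := by
  ext n
  simp [starPolynomialSeries]

variable [Algebra ℝ R]

lemma linearSeries_mul (F G : R[X]⟦X⟧) : linearSeries (F * G) =
    evalSeries 0 F * linearSeries G + linearSeries F * evalSeries 0 G := by
  ext n
  simp only [map_add, PowerSeries.coeff_mul, coeff_linearSeries, coeff_evalSeries, evalAt_zero,
    Polynomial.finsetSum_coeff, Polynomial.mul_coeff_one, Finset.sum_add_distrib]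

lemma eq_of_forall_evalSeries_natCast {F G : R[X]⟦X⟧}
    (h : ∀ k : ℕ, evalSeries (k : ℝ) F = evalSeries (k : ℝ) G) : F = G := by
  ext1 n
  refine sub_eq_zero.1 (eq_zero_of_forall_evalAt_natCast fun k => ?_)
  rw [map_sub, ← coeff_evalSeries, ← coeff_evalSeries, h, sub_self]

variable [StarRing R] [StarModule ℝ R]

lemma evalSeries_starPolynomialSeries (x : ℝ) (G : R[X]⟦X⟧) :
    evalSeries x (starPolynomialSeries G) = starSeries (evalSeries x G) := by
  ext n
  rw [coeff_evalSeries, starPolynomialSeries, PowerSeries.coeff_mk, evalAt_mapCoeff,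
    coeff_starSeries, coeff_evalSeries, evalAt_eq_sum, Polynomial.sum_def, Polynomial.sum_def,
    star_sum]
  simp

/-- Differentiate `star (G(q)) * G(q) = 1` at `q = 0`. -/
lemma starSeries_linearSeries_add_linearSeries {G : R[X]⟦X⟧}
    (hG0 : evalSeries 0 G = 1)
    (hG : ∀ k : ℕ, starSeries (evalSeries (k : ℝ) G) * evalSeries (k : ℝ) G = 1) :
    starSeries (linearSeries G) + linearSeries G = 0 := by
  have hone : starPolynomialSeries G * G = 1 := eq_of_forall_evalSeries_natCast fun k => by
    rw [map_mul, evalSeries_starPolynomialSeries, hG, map_one]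
  have hstar0 : evalSeries 0 (starPolynomialSeries G) = 1 := by
    simpa [evalSeries_starPolynomialSeries, hG0] using hG 0
  simpa only [linearSeries_mul, linearSeries_starPolynomialSeries, hG0, hstar0, one_mul, mul_one,
    linearSeries_one, add_comm] using congrArg linearSeries hone

end Unitarity

section Extrapolation

open PowerSeries Finset

variable {R : Type*} [Ring R] [Algebra ℝ R] {σ : Type*} [Fintype σ]

/-- The power series in the total length `X` of the time step that represents the combination with
weights `a j` of compositions of `k j` steps of length `X / k j`, where `G` represents the
composition of `q` steps of length `X`. -/
noncomputable def extrapolationSeries (a : σ → ℝ) (k : σ → ℕ) (G : (Polynomial R)⟦X⟧) : R⟦X⟧ :=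
  ∑ j, a j • scale ((k j : ℝ)⁻¹) (evalSeries (k j : ℝ) G)

lemma evalAt_eq_sum_of_parity {p : Polynomial R} {n : ℕ} (hdeg : p.natDegree ≤ n)
    (hpar : ∀ i, Odd (n + i) → p.coeff i = 0) (x : ℝ) :
    evalAt x p = ∑ l ∈ range (n / 2 + 1), x ^ (n - 2 * l) • p.coeff (n - 2 * l) := by
  rw [evalAt_eq_sum_range x (Nat.lt_succ_of_le hdeg)]
  symm
  refine Finset.sum_of_injOn (fun l => n - 2 * l) (fun l hl m hm h => ?_) (fun l _ => ?_)
    (fun i hi hi' => ?_) fun l _ => rfl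
  · simp only [coe_range, Set.mem_Iio] at hl hm h
    omega
  · simp only [coe_range, Set.mem_Iio]
    omega
  · rw [hpar i (Nat.not_even_iff_odd.1 fun heven => hi' ?_), smul_zero]
    rw [mem_range] at hi
    obtain ⟨m, hm⟩ := heven
    refine ⟨n - m, ?_, ?_⟩
    · rw [coe_range, Set.mem_Iio]
      omega
    · change n - 2 * (n - m) = i
      omega

variable {a : σ → ℝ} {k : σ → ℕ} {G : (Polynomial R)⟦X⟧}

lemma coeff_extrapolationSeries (hk : ∀ j, 1 ≤ k j) {n : ℕ}
    (hdeg : (coeff n G).natDegree ≤ n) (hpar : ∀ i, Odd (n + i) → (coeff n G).coeff i = 0) :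
    coeff n (extrapolationSeries a k G) = ∑ l ∈ range (n / 2 + 1),
      (∑ j, a j * ((k j : ℝ) ^ (2 * l))⁻¹) • (coeff n G).coeff (n - 2 * l) := by
  have hterm : ∀ j, coeff n (a j • scale ((k j : ℝ)⁻¹) (evalSeries (k j : ℝ) G)) =
      ∑ l ∈ range (n / 2 + 1),
        (a j * ((k j : ℝ) ^ (2 * l))⁻¹) • (coeff n G).coeff (n - 2 * l) := fun j => by
    have hkj : (k j : ℝ) ≠ 0 := Nat.cast_ne_zero.2 (Nat.one_le_iff_ne_zero.1 (hk j))
    rw [PowerSeries.coeff_smul, coeff_scale, coeff_evalSeries, evalAt_eq_sum_of_parity hdeg hpar,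
      Finset.smul_sum, Finset.smul_sum]
    refine Finset.sum_congr rfl fun l hl => ?_
    have hln : 2 * l ≤ n := by
      rw [mem_range] at hl
      omega
    rw [smul_smul, smul_smul, inv_pow, pow_sub₀ _ hkj hln, mul_assoc,
      inv_mul_cancel_left₀ (pow_ne_zero n hkj)]
  simp only [extrapolationSeries, map_sum, hterm, Finset.sum_smul]
  exact Finset.sum_comm

section Vandermonde

variable {M : ℕ} (hM : 1 ≤ M) (hk : ∀ j, 1 ≤ k j)
  (hak : ∀ l < M, ∑ j, a j * ((k j : ℝ) ^ (2 * l))⁻¹ = if l = 0 then 1 else 0)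
  (hdeg : ∀ n, (coeff n G).natDegree ≤ n)
  (hpar : ∀ n i, Odd (n + i) → (coeff n G).coeff i = 0)
include hM hk hak hdeg hpar

lemma coeff_extrapolationSeries_of_le (hG0 : evalSeries 0 G = 1) {n : ℕ} (hn : n ≤ 2 * M) :
    coeff n (extrapolationSeries a k G) = coeff n (diagonalSeries G) := by
  rw [coeff_extrapolationSeries hk (hdeg n) (hpar n), Finset.sum_eq_single_of_mem 0 (by simp)]
  · rw [hak 0 hM, if_pos rfl, one_smul, mul_zero, Nat.sub_zero, coeff_diagonalSeries]
  · intro l hl hl0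
    rw [mem_range] at hl
    rcases lt_or_ge l M with hlM | hlM
    · rw [hak l hlM, if_neg hl0, zero_smul]
    · rw [show n - 2 * l = 0 by omega, ← evalAt_zero, ← coeff_evalSeries, hG0,
        PowerSeries.coeff_one, if_neg (by omega), smul_zero]

lemma coeff_extrapolationSeries_two_mul_add_one :
    coeff (2 * M + 1) (extrapolationSeries a k G) = coeff (2 * M + 1) (diagonalSeries G)
      + (∑ j, a j * ((k j : ℝ) ^ (2 * M))⁻¹) • coeff (2 * M + 1) (linearSeries G) := by
  rw [coeff_extrapolationSeries hk (hdeg _) (hpar _),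
    Finset.sum_eq_add_of_mem 0 M (by simp) (by simp; omega) (by omega)]
  · rw [hak 0 hM, if_pos rfl, one_smul, mul_zero, Nat.sub_zero, coeff_diagonalSeries,
      Nat.add_sub_cancel_left, coeff_linearSeries]
  · rintro l hl ⟨hl0, hlM⟩
    rw [mem_range] at hl
    rw [hak l (by omega), if_neg hl0, zero_smul]

end Vandermonde

end Extrapolation

section Increments

open Asymptotics Filter Set

/-- The filter of the increments `h → 0` with `s + h ∈ I`. -/
def increments (I : Set ℝ) (s : ℝ) : Filter ℝ := 𝓝[(s + ·) ⁻¹' I] 0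

variable {I : Set ℝ} {s : ℝ}

lemma increments_le_nhds : increments I s ≤ 𝓝 0 := nhdsWithin_le_nhds

lemma tendsto_add_increments : Tendsto (s + ·) (increments I s) (𝓝[I] s) :=
  tendsto_nhdsWithin_iff.2 ⟨((continuous_const_add s).tendsto' 0 s (add_zero s)).mono_left
    increments_le_nhds, self_mem_nhdsWithin⟩

lemma tendsto_sub_increments : Tendsto (· - s) (𝓝[I] s) (increments I s) :=
  tendsto_nhdsWithin_iff.2 ⟨((continuous_sub_right s).tendsto' s 0 (sub_self s)).mono_left
    nhdsWithin_le_nhds, eventually_mem_nhdsWithin.mono fun t ht => by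
      rwa [mem_preimage, add_sub_cancel]⟩

lemma isBigO_nhdsWithin_iff_increments {E F : Type*} [Norm E] [Norm F] {f : ℝ → E}
    {g : ℝ → F} : f =O[𝓝[I] s] g ↔
      (fun h => f (s + h)) =O[increments I s] fun h => g (s + h) := by
  refine ⟨fun h => h.comp_tendsto tendsto_add_increments, fun h =>
    (h.comp_tendsto tendsto_sub_increments).congr (fun t => ?_) fun t => ?_⟩ <;>
  simp only [Function.comp_apply, add_sub_cancel]

lemma eventually_const_mul_mem_of_pos {J : Set ℝ} (hJ : J.OrdConnected) (h0 : 0 ∈ J) {c : ℝ}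
    (hc : 0 ≤ c) : ∀ᶠ h in 𝓝[J] (0 : ℝ), 0 < h → c * h ∈ J := by
  by_cases hy : ∃ y ∈ J, 0 < y
  · obtain ⟨y, hyJ, hy⟩ := hy
    have hlt : ∀ᶠ h in 𝓝[J] (0 : ℝ), c * h < y := nhdsWithin_le_nhds <|
      ((continuous_const_mul c).tendsto' 0 0 (mul_zero c)).eventually_lt_const hy
    filter_upwards [hlt] with h hh hpos using hJ.out h0 hyJ ⟨mul_nonneg hc hpos.le, hh.le⟩
  · filter_upwards [self_mem_nhdsWithin] with h hh hpos using absurd ⟨h, hh, hpos⟩ hy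

lemma eventually_const_mul_mem {J : Set ℝ} (hJ : J.OrdConnected) (h0 : 0 ∈ J) {c : ℝ}
    (hc : 0 ≤ c) : ∀ᶠ h in 𝓝[J] (0 : ℝ), c * h ∈ J := by
  have hneg : Tendsto (-·) (𝓝[J] (0 : ℝ)) (𝓝[Neg.neg ⁻¹' J] 0) :=
    tendsto_nhdsWithin_iff.2 ⟨(continuous_neg.tendsto' 0 0 neg_zero).mono_left nhdsWithin_le_nhds,
      eventually_mem_nhdsWithin.mono fun h hh => by rwa [mem_preimage, neg_neg]⟩
  have hJneg : (Neg.neg ⁻¹' J).OrdConnected := hJ.preimage_anti fun _ _ => neg_le_neg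
  filter_upwards [eventually_const_mul_mem_of_pos hJ h0 hc,
    hneg.eventually (eventually_const_mul_mem_of_pos hJneg (by rwa [mem_preimage, neg_zero]) hc)]
    with h hpos hneg
  rcases lt_trichotomy h 0 with hh | rfl | hh
  · simpa only [mem_preimage, mul_neg, neg_neg] using hneg (neg_pos.2 hh)
  · rwa [mul_zero]
  · exact hpos hh

variable (hI : Convex ℝ I) (hs : s ∈ I)
include hI hs

lemma tendsto_const_mul_increments {c : ℝ} (hc : 0 ≤ c) :
    Tendsto (c * ·) (increments I s) (increments I s) :=
  tendsto_nhdsWithin_iff.2 ⟨((continuous_const_mul c).tendsto' 0 0 (mul_zero c)).mono_left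
    increments_le_nhds, eventually_const_mul_mem (hI.translate_preimage_right s).ordConnected
      (by rwa [mem_preimage, add_zero]) hc⟩

lemma eventually_add_mul_mem {c : ℝ} (hc : 0 ≤ c) : ∀ᶠ h in increments I s, s + c * h ∈ I :=
  tendsto_add_increments.comp (tendsto_const_mul_increments hI hs hc) |>.eventually
    self_mem_nhdsWithin

lemma increments_neBot (hnt : I.Nontrivial) : (increments I s ⊓ 𝓟 {0}ᶜ).NeBot := by
  have hacc : (𝓝[≠] s ⊓ 𝓟 I).NeBot := hI.isPreconnected.preperfect_of_nontrivial hnt s hs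
  have hle : Tendsto (· - s) (𝓝[≠] s ⊓ 𝓟 I) (increments I s ⊓ 𝓟 {0}ᶜ) := by
    rw [nhdsWithin, inf_assoc, inf_comm (𝓟 _), ← inf_assoc, ← nhdsWithin]
    exact tendsto_sub_increments.inf (tendsto_principal_principal.2 fun t ht =>
      sub_ne_zero.2 ht)
  exact hacc.map _ |>.mono hle

end Increments

section Taylor

open Asymptotics Filter Set

variable {𝔸 : Type*} [NormedRing 𝔸] [NormedAlgebra ℝ 𝔸] {I : Set ℝ} {s : ℝ}

/-- The Taylor series at `s` of a function on `I`. -/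
noncomputable def taylorSeries (G : ℝ → 𝔸) (I : Set ℝ) (s : ℝ) : PowerSeries 𝔸 :=
  PowerSeries.mk fun r => taylorCoeffWithin G r I s

lemma coeff_zero_taylorSeries (G : ℝ → 𝔸) (I : Set ℝ) (s : ℝ) :
    PowerSeries.coeff 0 (taylorSeries G I s) = G s := by
  simp [taylorSeries, taylorCoeffWithin]

lemma hasExpansion_taylorSeries {G : ℝ → 𝔸} (hI : Convex ℝ I) (hG : ContDiffOn ℝ ∞ G I)
    (hs : s ∈ I) : HasExpansion (increments I s) (fun h => G (s + h)) (taylorSeries G I s) := by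
  rintro (_ | n)
  · have hcont := (hG.continuousOn s hs).tendsto.comp (tendsto_add_increments (I := I))
    simpa [HasExpansionUpTo] using hcont.isBigO_one ℝ
  · have htaylor := (taylor_isLittleO (n := n + 1) hI hs
      (hG.of_le (by exact_mod_cast le_top))).isBigO.comp_tendsto tendsto_add_increments
    have hlast := pow_smul_isBigO (l := increments I s) (taylorCoeffWithin G (n + 1) I s) (n + 1)
    refine (htaylor.congr_right fun x => ?_).add hlast |>.congr_left fun x => ?_
    · simp only [Function.comp_apply, add_sub_cancel_left]
    · simp only [Function.comp_apply, taylor_within_apply, taylorSeries, PowerSeries.coeff_mk,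
        taylorCoeffWithin, add_sub_cancel_left, smul_smul]
      rw [Finset.sum_range_succ _ (n + 1)]
      simp only [mul_comm]
      abel

end Taylor

section LinearODE

open Asymptotics Filter Set Finset

variable {𝔸 : Type*} [NormedRing 𝔸] [NormedAlgebra ℝ 𝔸]

lemma isBigO_pow_succ_of_hasDerivWithinAt {E : Type*} [NormedAddCommGroup E] [NormedSpace ℝ E]
    {J : Set ℝ} (hJ : Convex ℝ J) (h0 : 0 ∈ J) {r r' : ℝ → E} (hr0 : r 0 = 0)
    (hr : ∀ h ∈ J, HasDerivWithinAt r (r' h) J h) {n : ℕ}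
    (hO : r' =O[𝓝[J] 0] fun h => h ^ n) : r =O[𝓝[J] 0] fun h => h ^ (n + 1) := by
  obtain ⟨C, hC0, hC⟩ := hO.exists_nonneg
  obtain ⟨ε, hε, hball⟩ := Metric.mem_nhdsWithin_iff.1 hC.bound
  refine IsBigO.of_bound C ?_
  filter_upwards [nhdsWithin_le_nhds (Metric.ball_mem_nhds 0 hε), self_mem_nhdsWithin]
    with h hhε hhJ
  rw [Metric.mem_ball, dist_zero_right] at hhε
  have hbound : ∀ x ∈ J ∩ Icc (-|h|) |h|, ‖r' x‖ ≤ C * |h| ^ n := fun x hx => by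
    have hxh : |x| ≤ |h| := abs_le.2 hx.2
    calc ‖r' x‖ ≤ C * ‖x ^ n‖ :=
          hball ⟨by rw [Metric.mem_ball, dist_zero_right]; exact hxh.trans_lt hhε, hx.1⟩
      _ ≤ C * |h| ^ n := by
          rw [norm_pow, Real.norm_eq_abs]
          gcongr
  have hmean := (hJ.inter (convex_Icc _ _)).norm_image_sub_le_of_norm_hasDerivWithin_le
    (fun x hx => (hr x hx.1).mono inter_subset_left) hbound
    ⟨h0, by simp, by simp⟩ ⟨hhJ, neg_abs_le h, le_abs_self h⟩
  rwa [hr0, sub_zero, sub_zero, Real.norm_eq_abs, mul_assoc, ← pow_succ, ← Real.norm_eq_abs,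
    ← norm_pow] at hmean

lemma HasExpansionUpTo.of_hasDerivWithinAt {J : Set ℝ} (hJ : Convex ℝ J) (h0 : 0 ∈ J)
    {r r' : ℝ → 𝔸} {P Q : PowerSeries 𝔸} {n : ℕ} (hr0 : r 0 = PowerSeries.coeff 0 P)
    (hr : ∀ h ∈ J, HasDerivWithinAt r (r' h) J h) (hr' : HasExpansionUpTo n (𝓝[J] 0) r' Q)
    (hPQ : ∀ i : ℕ, ((i : ℝ) + 1) • PowerSeries.coeff (i + 1) P = PowerSeries.coeff i Q) :
    HasExpansionUpTo (n + 1) (𝓝[J] 0) r P := by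
  have hpoly : ∀ h : ℝ, HasDerivAt (fun x => ∑ i ∈ range (n + 1), x ^ i • PowerSeries.coeff i P)
      (∑ i ∈ range n, h ^ i • PowerSeries.coeff i Q) h := fun h => by
    simp only [sum_range_succ', pow_zero, one_smul]
    refine (HasDerivAt.fun_sum fun i _ => ?_).add_const _
    rw [← hPQ, smul_smul, mul_comm]
    simpa using (hasDerivAt_pow (i + 1) h).smul_const (PowerSeries.coeff (i + 1) P)
  refine isBigO_pow_succ_of_hasDerivWithinAt hJ h0 ?_
    (fun h hh => (hr h hh).sub (hpoly h).hasDerivWithinAt) hr'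
  simp [sum_range_succ', hr0]

lemma hasExpansion_of_hasDerivWithinAt_mul {J : Set ℝ} (hJ : Convex ℝ J) (h0 : 0 ∈ J)
    {A u : ℝ → 𝔸} {Q P : PowerSeries 𝔸} (hA : HasExpansion (𝓝[J] 0) A Q)
    (hu : ∀ h ∈ J, HasDerivWithinAt u (A h * u h) J h) (hu0 : u 0 = PowerSeries.coeff 0 P)
    (hP : ∀ i : ℕ, ((i : ℝ) + 1) • PowerSeries.coeff (i + 1) P = PowerSeries.coeff i (Q * P)) :
    HasExpansion (𝓝[J] 0) u P := by
  intro n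
  induction n with
  | zero => simpa [HasExpansionUpTo] using (hu 0 h0).continuousWithinAt.tendsto.isBigO_one ℝ
  | succ n ih => exact .of_hasDerivWithinAt hJ h0 hu0 hu ((hA n).mul nhdsWithin_le_nhds ih) hP

end LinearODE

section OneStepMethods

variable {E : Type*} [NormedAddCommGroup E] {S : Type*} [Monoid S]

/-- The one-step method `V` approximates `U` to order `n` on `I`. -/
def HasOrder (n : ℕ) (I : Set ℝ) (U V : ℝ → ℝ → E) : Prop :=
  ∀ s ∈ I, (fun t => V t s - U t s) =O[𝓝[I] s] fun t => (t - s) ^ (n + 1)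

lemma hasOrder_iff {n : ℕ} {I : Set ℝ} {U V : ℝ → ℝ → E} : HasOrder n I U V ↔
    ∀ s ∈ I, (fun h => V (s + h) s - U (s + h) s) =O[increments I s] fun h => h ^ (n + 1) := by
  simp only [HasOrder, isBigO_nhdsWithin_iff_increments, add_sub_cancel_left]

lemma HasOrder.mono {m n : ℕ} {I : Set ℝ} {U V : ℝ → ℝ → E} (hUV : HasOrder n I U V)
    (hmn : m ≤ n) : HasOrder m I U V :=
  hasOrder_iff.2 fun s hs => (hasOrder_iff.1 hUV s hs).trans
    (pow_isBigO_pow_of_le increments_le_nhds (Nat.succ_le_succ hmn))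

/-- The time-ordered composition of `k` steps of length `δ` of the one-step method `V`, starting
at time `s`. -/
def composition (V : ℝ → ℝ → S) (k : ℕ) (s δ : ℝ) : S :=
  ((List.range k).map fun q : ℕ => V (s + (q + 1) * δ) (s + q * δ)).reverse.prod

lemma composition_zero (V : ℝ → ℝ → S) (s δ : ℝ) : composition V 0 s δ = 1 := rfl

lemma composition_succ (V : ℝ → ℝ → S) (k : ℕ) (s δ : ℝ) : composition V (k + 1) s δ =
    V (s + (k + 1) * δ) (s + k * δ) * composition V k s δ := by
  simp [composition, List.range_succ]

/-- The combination with weights `a j` of the compositions of `k j` equal steps from `s` to `t`. -/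
noncomputable def extrapolation {R : Type*} [Ring R] [Algebra ℝ R] {σ : Type*} [Fintype σ]
    (a : σ → ℝ) (k : σ → ℕ) (V : ℝ → ℝ → R) (t s : ℝ) : R :=
  ∑ j, a j • composition V (k j) s ((k j : ℝ)⁻¹ * (t - s))

lemma extrapolation_unit {R : Type*} [Ring R] [Algebra ℝ R] (V : ℝ → ℝ → R) :
    extrapolation (1 : Unit → ℝ) 1 V = V := by
  ext t s
  simp [extrapolation, composition]

end OneStepMethods

section Formulas

open Asymptotics Filter Set

variable {𝔸 : Type*} [NormedRing 𝔸] [NormedAlgebra ℝ 𝔸]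

/-- `U t s` is the evolution from time `s` to time `t` generated by `A` on `I`: it solves
`∂ₜ U(t, s) = A(t) U(t, s)`, `U(s, s) = 1`. (A propagator is the case `A = -i H`.) -/
def IsEvolution (I : Set ℝ) (A : ℝ → 𝔸) (U : ℝ → ℝ → 𝔸) : Prop :=
  ∀ s ∈ I, U s s = 1 ∧ ∀ t ∈ I, HasDerivWithinAt (fun τ => U τ s) (A t * U t s) I t

/-- The product of the exponentials `exp((t - s) G(s + θ (t - s)))` over the entries `(G, θ)` of
`L`. -/
noncomputable def expProduct (L : List ((ℝ → 𝔸) × ℝ)) (t s : ℝ) : 𝔸 :=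
  (L.map fun p => NormedSpace.exp ((t - s) • p.1 (s + p.2 * (t - s)))).prod

/-- On `I`, the one-step method `V` is the product of exponentials with the smooth generators and
the relative evaluation times listed in `L`. -/
structure IsExpProductFormula (I : Set ℝ) (L : List ((ℝ → 𝔸) × ℝ)) (V : ℝ → ℝ → 𝔸) : Prop where
  contDiffOn : ∀ p ∈ L, ContDiffOn ℝ ∞ p.1 I
  mem_Icc : ∀ p ∈ L, p.2 ∈ Icc (0 : ℝ) 1
  eq_expProduct : ∀ t ∈ I, ∀ s ∈ I, V t s = expProduct L t s

variable {I : Set ℝ} {s : ℝ} (hI : Convex ℝ I) (hs : s ∈ I)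
include hI hs

lemma IsEvolution.hasExpansion {A : ℝ → 𝔸} {U : ℝ → ℝ → 𝔸} (hU : IsEvolution I A U)
    {F : PowerSeries (Polynomial 𝔸)} (hF : IsGraded F)
    (hA : HasExpansion (increments I s) (fun h => A (s + h)) (topSeries F)) :
    HasExpansion (increments I s) (fun h => U (s + h) s) (diagonalSeries (globalSeries F)) := by
  refine hasExpansion_of_hasDerivWithinAt_mul (hI.translate_preimage_right s)
    (by rwa [mem_preimage, add_zero]) hA (fun h hh => ?_) ?_
    (succ_smul_coeff_succ_diagonalSeries hF)
  · have hderiv := ((hU s hs).2 (s + h) hh).scomp (h := (s + ·)) (h' := (1 : ℝ)) h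
      ((hasDerivAt_id h).const_add s).hasDerivWithinAt (mapsTo_preimage _ _)
    rwa [one_smul] at hderiv
  · rw [add_zero, (hU s hs).1, coeff_diagonalSeries, coeff_zero_globalSeries,
      Polynomial.coeff_one_zero]

/-- The series of the steps of a product formula with generators and evaluation times `L`, where
the generators are represented by their Taylor series at `s`. -/
noncomputable def formulaSeries (L : List ((ℝ → 𝔸) × ℝ)) (I : Set ℝ) (s : ℝ) :
    PowerSeries (Polynomial 𝔸) :=
  stepSeries (L.map fun p => (taylorSeries p.1 I s, p.2))

omit hI hs in
lemma coeff_zero_formulaSeries (L : List ((ℝ → 𝔸) × ℝ)) (I : Set ℝ) (s : ℝ) :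
    PowerSeries.coeff 0 (formulaSeries L I s) = 1 := coeff_zero_stepSeries _

omit hI hs in
lemma isGraded_formulaSeries (L : List ((ℝ → 𝔸) × ℝ)) (I : Set ℝ) (s : ℝ) :
    IsGraded (formulaSeries L I s) := isGraded_stepSeries _

omit hI hs in
lemma evalSeries_formulaSeries (L : List ((ℝ → 𝔸) × ℝ)) (I : Set ℝ) (s q : ℝ) :
    evalSeries q (formulaSeries L I s) = (L.map fun p =>
      expOf (PowerSeries.X * scale (q + p.2) (taylorSeries p.1 I s))).prod := by
  rw [formulaSeries, evalSeries_stepSeries, List.map_map]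
  rfl

omit hI hs in
lemma scale_neg_one_evalSeries_formulaSeries (L : List ((ℝ → 𝔸) × ℝ)) (I : Set ℝ) (s q : ℝ) :
    scale (-1) (evalSeries (-(q + 1)) (formulaSeries L I s)) = (L.map fun p =>
      expOf (PowerSeries.X * -scale (q + 1 - p.2) (taylorSeries p.1 I s))).prod := by
  rw [evalSeries_formulaSeries, map_list_prod, List.map_map]
  refine congrArg List.prod (List.map_congr_left fun p _ => ?_)
  rw [Function.comp_apply, scale_expOf, map_mul, scale_X, scale_scale,
    show -1 * (-(q + 1) + p.2) = q + 1 - p.2 by ring, neg_one_smul, neg_mul, mul_neg]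

namespace IsExpProductFormula

variable {L : List ((ℝ → 𝔸) × ℝ)} {V : ℝ → ℝ → 𝔸}

section Expansion

variable [CompleteSpace 𝔸] (hV : IsExpProductFormula I L V)
include hV

lemma hasExpansion_step {q : ℝ} (hq : 0 ≤ q) :
    HasExpansion (increments I s) (fun δ => V (s + (q + 1) * δ) (s + q * δ))
      (evalSeries q (formulaSeries L I s)) := by
  rw [evalSeries_formulaSeries]
  refine (HasExpansion.list_prod increments_le_nhds L fun p hp =>
    .exp increments_le_nhds ((hasExpansion_taylorSeries hI (hV.contDiffOn p hp) hs).comp_mul_left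
      (tendsto_const_mul_increments hI hs (add_nonneg hq (hV.mem_Icc p hp).1)))).congr ?_
  filter_upwards [eventually_add_mul_mem hI hs hq,
    eventually_add_mul_mem hI hs (add_nonneg hq zero_le_one)] with δ hδ hδ'
  rw [hV.eq_expProduct _ hδ' _ hδ, expProduct]
  refine congrArg List.prod (List.map_congr_left fun p _ => ?_)
  rw [show s + (q + 1) * δ - (s + q * δ) = δ by ring,
    show s + q * δ + p.2 * δ = s + (q + p.2) * δ by ring]

lemma hasExpansion_reversed_step {q : ℝ} (hq : 0 ≤ q) :
    HasExpansion (increments I s) (fun δ => V (s + q * δ) (s + (q + 1) * δ))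
      (scale (-1) (evalSeries (-(q + 1)) (formulaSeries L I s))) := by
  rw [scale_neg_one_evalSeries_formulaSeries]
  refine (HasExpansion.list_prod increments_le_nhds L fun p hp =>
    .exp increments_le_nhds ((hasExpansion_taylorSeries hI (hV.contDiffOn p hp) hs).comp_mul_left
      (c := q + 1 - p.2) (tendsto_const_mul_increments hI hs
        (by linarith [(hV.mem_Icc p hp).2]))).neg).congr ?_
  filter_upwards [eventually_add_mul_mem hI hs hq,
    eventually_add_mul_mem hI hs (add_nonneg hq zero_le_one)] with δ hδ hδ'
  rw [hV.eq_expProduct _ hδ _ hδ', expProduct]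
  refine congrArg List.prod (List.map_congr_left fun p _ => ?_)
  rw [show s + q * δ - (s + (q + 1) * δ) = -δ by ring,
    show s + (q + 1) * δ + p.2 * -δ = s + (q + 1 - p.2) * δ by ring, smul_neg, neg_smul]

lemma hasExpansion_composition (k : ℕ) : HasExpansion (increments I s) (composition V k s)
    (evalSeries (k : ℝ) (globalSeries (formulaSeries L I s))) := by
  induction k with
  | zero =>
    rw [Nat.cast_zero, evalSeries_zero_globalSeries]
    exact HasExpansion.one
  | succ k ih =>
    rw [Nat.cast_succ, evalSeries_add_one_globalSeries (coeff_zero_formulaSeries L I s)]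
    exact ((hV.hasExpansion_step hI hs k.cast_nonneg).mul increments_le_nhds ih).congr
      (.of_forall fun δ => (composition_succ V k s δ).symm)

lemma hasExpansion_extrapolation {σ : Type*} [Fintype σ] (a : σ → ℝ) (k : σ → ℕ) :
    HasExpansion (increments I s) (fun h => extrapolation a k V (s + h) s)
      (extrapolationSeries a k (globalSeries (formulaSeries L I s))) := by
  simp only [extrapolation, add_sub_cancel_left]
  exact .finset_sum fun j _ => ((hV.hasExpansion_composition hI hs (k j)).comp_mul_left
    (tendsto_const_mul_increments hI hs (by positivity))).const_smul (a j)

end Expansion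

end IsExpProductFormula

end Formulas

section SymmetricExtrapolation

open Asymptotics Filter Set

variable {𝔸 : Type*} [NormedRing 𝔸] [NormedAlgebra ℝ 𝔸]

lemma coeff_one_diagonalSeries_globalSeries {F : PowerSeries (Polynomial 𝔸)} (hF : IsGraded F) :
    PowerSeries.coeff 1 (diagonalSeries (globalSeries F)) = PowerSeries.coeff 0 (topSeries F) := by
  simpa [PowerSeries.coeff_mul, coeff_diagonalSeries, coeff_zero_globalSeries,
    -PowerSeries.coeff_zero_eq_constantCoeff] using succ_smul_coeff_succ_diagonalSeries hF 0

lemma topSeries_formulaSeries (L : List ((ℝ → 𝔸) × ℝ)) (I : Set ℝ) (s : ℝ) :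
    topSeries (formulaSeries L I s) = (L.map fun p => taylorSeries p.1 I s).sum := by
  rw [formulaSeries, topSeries_stepSeries, List.map_map]
  rfl

lemma coeff_zero_topSeries_formulaSeries (L : List ((ℝ → 𝔸) × ℝ)) (I : Set ℝ) (s : ℝ) :
    PowerSeries.coeff 0 (topSeries (formulaSeries L I s)) = (L.map fun p => p.1 s).sum := by
  rw [topSeries_formulaSeries, map_list_sum, List.map_map]
  exact congrArg List.sum (List.map_congr_left fun p _ => coeff_zero_taylorSeries _ _ _)

namespace IsExpProductFormula

variable {I : Set ℝ} {s : ℝ} (hI : Convex ℝ I) (hs : s ∈ I) {L : List ((ℝ → 𝔸) × ℝ)}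
  {A : ℝ → 𝔸} {U V : ℝ → ℝ → 𝔸} (hV : IsExpProductFormula I L V)
include hI hs hV

lemma hasExpansion_generator (hLA : ∀ t ∈ I, (L.map fun p => p.1 t).sum = A t) :
    HasExpansion (increments I s) (fun h => A (s + h)) (topSeries (formulaSeries L I s)) := by
  rw [topSeries_formulaSeries]
  refine (HasExpansion.list_sum L fun p hp =>
    hasExpansion_taylorSeries hI (hV.contDiffOn p hp) hs).congr ?_
  filter_upwards [tendsto_add_increments.eventually self_mem_nhdsWithin] with h hh using hLA _ hh

variable [CompleteSpace 𝔸] (hU : IsEvolution I A U)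
include hU

lemma sum_generators_eq (hnt : I.Nontrivial) (hA : ContDiffOn ℝ ∞ A I) (hUV : HasOrder 1 I U V) :
    (L.map fun p => p.1 s).sum = A s := by
  have := increments_neBot hI hs hnt
  have hAexp : HasExpansion (increments I s) (fun h => A (s + h))
      (topSeries (formulaSeries [(A, 0)] I s)) := by
    rw [topSeries_formulaSeries, List.map_singleton, List.sum_singleton]
    exact hasExpansion_taylorSeries hI hA hs
  have hVexp : HasExpansion (increments I s) (fun h => V (s + h) s)
      (evalSeries 0 (formulaSeries L I s)) := by
    simpa using hV.hasExpansion_step hI hs le_rfl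
  have hcoeff := hVexp.coeff_eq increments_le_nhds
    (hU.hasExpansion hI hs (isGraded_formulaSeries _ _ _) hAexp) (hasOrder_iff.1 hUV s hs) 1
    one_lt_two
  rwa [coeff_one_diagonalSeries_globalSeries (isGraded_formulaSeries _ _ _), coeff_evalSeries,
    evalAt_zero, ← coeff_topSeries, coeff_zero_topSeries_formulaSeries,
    coeff_zero_topSeries_formulaSeries, List.map_singleton, List.sum_singleton] at hcoeff

variable {σ : Type*} [Fintype σ] {a : σ → ℝ} {k : σ → ℕ}

lemma hasExpansion_extrapolation_sub (hLA : ∀ t ∈ I, (L.map fun p => p.1 t).sum = A t) :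
    HasExpansion (increments I s) (fun h => extrapolation a k V (s + h) s - U (s + h) s)
      (extrapolationSeries a k (globalSeries (formulaSeries L I s))
        - diagonalSeries (globalSeries (formulaSeries L I s))) :=
  (hV.hasExpansion_extrapolation hI hs a k).sub
    (hU.hasExpansion hI hs (isGraded_formulaSeries _ _ _) (hV.hasExpansion_generator hI hs hLA))

omit hU

variable (hnt : I.Nontrivial) (hinv : ∀ t ∈ I, ∀ s ∈ I, V s t * V t s = 1)
include hnt hinv

lemma evalSeries_mul_scale_evalSeries_formulaSeries (q : ℕ) :
    evalSeries (q : ℝ) (formulaSeries L I s)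
      * scale (-1) (evalSeries (-((q : ℝ) + 1)) (formulaSeries L I s)) = 1 := by
  have := increments_neBot hI hs hnt
  refine HasExpansion.unique increments_le_nhds
    (((hV.hasExpansion_step hI hs q.cast_nonneg).mul increments_le_nhds
      (hV.hasExpansion_reversed_step hI hs q.cast_nonneg)).congr ?_) HasExpansion.one
  filter_upwards [eventually_add_mul_mem hI hs q.cast_nonneg,
    eventually_add_mul_mem hI hs (add_nonneg q.cast_nonneg zero_le_one)] with δ hδ hδ'
    using hinv _ hδ _ hδ'

lemma coeff_coeff_globalSeries_eq_zero_of_odd {n i : ℕ} (hni : Odd (n + i)) :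
    (PowerSeries.coeff n (globalSeries (formulaSeries L I s))).coeff i = 0 :=
  coeff_coeff_eq_zero_of_odd (scale_neg_one_evalSeries_neg_globalSeries
    (coeff_zero_formulaSeries L I s)
    (hV.evalSeries_mul_scale_evalSeries_formulaSeries hI hs hnt hinv)) hni

variable (hLA : ∀ t ∈ I, (L.map fun p => p.1 t).sum = A t) {M : ℕ} (hM : 1 ≤ M)
  (hk : ∀ j, 1 ≤ k j)
  (hak : ∀ l < M, ∑ j, a j * ((k j : ℝ) ^ (2 * l))⁻¹ = if l = 0 then 1 else 0)
include hU hLA hM hk hak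

omit hs in
theorem hasOrder_extrapolation : HasOrder (2 * M) I U (extrapolation a k V) :=
  hasOrder_iff.2 fun s hs =>
    (hV.hasExpansion_extrapolation_sub hI hs hU hLA).isBigO_of_coeff_eq_zero fun n hn => by
      rw [map_sub, sub_eq_zero]
      exact coeff_extrapolationSeries_of_le hM hk hak
        (natDegree_coeff_globalSeries_le (isGraded_formulaSeries L I s))
        (fun _ _ => hV.coeff_coeff_globalSeries_eq_zero_of_odd hI hs hnt hinv)
        (evalSeries_zero_globalSeries _) (Nat.le_of_lt_succ hn)

omit hs [Fintype σ] hM hk hak in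
theorem hasOrder_two : HasOrder 2 I U V := by
  have hcase := hV.hasOrder_extrapolation (a := (1 : Unit → ℝ)) (k := 1) (M := 1) hI hU hnt hinv hLA
    le_rfl (fun _ => le_rfl) (by simp)
  rwa [extrapolation_unit] at hcase

lemma extrapolation_sub_sub_isBigO :
    (fun h => extrapolation a k V (s + h) s - U (s + h) s - h ^ (2 * M + 1) •
      ((∑ j, a j * ((k j : ℝ) ^ (2 * M))⁻¹) •
        PowerSeries.coeff (2 * M + 1) (linearSeries (globalSeries (formulaSeries L I s)))))
      =O[increments I s] fun h => h ^ (2 * M + 2) := by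
  have hdeg := natDegree_coeff_globalSeries_le (isGraded_formulaSeries L I s)
  have hpar : ∀ n i, Odd (n + i) →
      (PowerSeries.coeff n (globalSeries (formulaSeries L I s))).coeff i = 0 := fun _ _ =>
    hV.coeff_coeff_globalSeries_eq_zero_of_odd hI hs hnt hinv
  have hlead := coeff_extrapolationSeries_two_mul_add_one hM hk hak hdeg hpar
  rw [← sub_eq_iff_eq_add', ← map_sub] at hlead
  rw [← hlead]
  refine (hV.hasExpansion_extrapolation_sub hI hs hU hLA).isBigO_sub_of_coeff_eq_zero
    fun n hn => ?_
  rw [map_sub, sub_eq_zero]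
  exact coeff_extrapolationSeries_of_le hM hk hak hdeg hpar
    (evalSeries_zero_globalSeries _) (Nat.le_of_lt_succ hn)

end IsExpProductFormula

end SymmetricExtrapolation

section Unitarity

open Asymptotics Filter Set

variable {𝔸 : Type*} [NormedRing 𝔸] [NormedAlgebra ℝ 𝔸] [StarRing 𝔸] [NormedStarGroup 𝔸]
  [StarModule ℝ 𝔸]

lemma star_mul_self_sub_one_isBigO {l : Filter ℝ} (hl : l ≤ 𝓝 0) {u w : ℝ → 𝔸} {E : 𝔸} {n : ℕ}
    (hu : ∀ᶠ h in l, star (u h) * u h = 1) (hu1 : (fun h => u h - 1) =O[l] fun h => h)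
    (hE : star E + E = 0)
    (hw : (fun h => w h - u h - h ^ (n + 1) • E) =O[l] fun h => h ^ (n + 2)) :
    (fun h => star (w h) * w h - 1) =O[l] fun h => h ^ (n + 2) := by
  have hwu : (fun h => w h - u h) =O[l] fun h => h ^ (n + 1) :=
    ((hw.trans (pow_isBigO_pow_of_le hl (Nat.le_succ _))).add (pow_smul_isBigO E _)).congr_left
      fun h => sub_add_cancel _ _
  have hw1 : (fun h => w h - 1) =O[l] fun h => h :=
    ((hwu.trans (by simpa only [pow_one] using
      pow_isBigO_pow_of_le hl (Nat.le_add_left 1 n))).add hu1).congr_left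
      fun h => sub_add_sub_cancel _ _ _
  have hstar : ∀ {f : ℝ → 𝔸} {g : ℝ → ℝ}, f =O[l] g → (fun h => star (f h)) =O[l] g :=
    fun hf => (isBigO_of_le l fun h => (norm_star _).le).trans hf
  refine ((((hstar hu1).mul hwu).congr_right fun h => (pow_succ' h _).symm).add
    ((((hstar hwu).mul hw1).congr_right fun h => (pow_succ h _).symm).add
      (hw.add (hstar hw)))).congr' ?_ .rfl
  filter_upwards [hu] with h hh
  have hstarE : star (h ^ (n + 1) • E) = -(h ^ (n + 1) • E) := by
    rw [star_smul, star_trivial, eq_neg_of_add_eq_zero_left hE, smul_neg]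
  calc _ = star (w h) * w h - star (u h) * u h := by
        simp only [star_sub, hstarE, star_one]
        generalize h ^ (n + 1) • E = x
        noncomm_ring
    _ = _ := by rw [hh]

lemma expProduct_mem_unitary [CompleteSpace 𝔸] {I : Set ℝ} (hI : Convex ℝ I)
    {L : List ((ℝ → 𝔸) × ℝ)} (hL : ∀ p ∈ L, p.2 ∈ Icc (0 : ℝ) 1)
    (hskew : ∀ p ∈ L, ∀ t ∈ I, p.1 t ∈ skewAdjoint 𝔸) {s t : ℝ} (hs : s ∈ I) (ht : t ∈ I) :
    expProduct L t s ∈ unitary 𝔸 := by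
  let _ : NormedAlgebra ℚ 𝔸 := NormedAlgebra.restrictScalars ℚ ℝ 𝔸
  refine list_prod_mem fun x hx => ?_
  obtain ⟨p, hp, rfl⟩ := List.mem_map.1 hx
  exact NormedSpace.exp_mem_unitary_of_mem_skewAdjoint
    (skewAdjoint.smul_mem _ (hskew p hp _ (hI.add_smul_sub_mem hs ht (hL p hp))))

omit [StarRing 𝔸] [NormedStarGroup 𝔸] [StarModule ℝ 𝔸] in
lemma IsEvolution.sub_one_isBigO {I : Set ℝ} {A : ℝ → 𝔸} {U : ℝ → ℝ → 𝔸} (hU : IsEvolution I A U)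
    {s : ℝ} (hs : s ∈ I) : (fun h => U (s + h) s - 1) =O[increments I s] fun h => h :=
  (((hU s hs).2 s hs).isBigO_sub.comp_tendsto
    (tendsto_add_increments.prodMk tendsto_const_pure)).congr
    (fun h => by rw [Function.comp_apply, (hU s hs).1]) fun h => add_sub_cancel_left s h

lemma IsEvolution.star_mul_self {I : Set ℝ} (hI : Convex ℝ I) {A : ℝ → 𝔸} {U : ℝ → ℝ → 𝔸}
    (hU : IsEvolution I A U) (hA : ∀ t ∈ I, A t ∈ skewAdjoint 𝔸) {s t : ℝ} (hs : s ∈ I)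
    (ht : t ∈ I) : star (U t s) * U t s = 1 := by
  have hderiv : ∀ τ ∈ I, HasDerivWithinAt (fun τ => star (U τ s) * U τ s) 0 I τ := fun τ hτ => by
    have hUτ := (hU s hs).2 τ hτ
    convert! hUτ.star.mul hUτ using 1
    rw [star_mul, skewAdjoint.mem_iff.1 (hA τ hτ)]
    noncomm_ring
  have hconst := hI.norm_image_sub_le_of_norm_hasDerivWithin_le hderiv
    (fun _ _ => norm_zero.le) hs ht
  rwa [zero_mul, norm_le_zero_iff, sub_eq_zero, (hU s hs).1, star_one, one_mul] at hconst

/-- `V` is a product formula on `I` with skew-adjoint generators (`-i` times Hermitian ones) which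
is symmetric under time reversal. -/
structure IsSymmetricProductFormula (I : Set ℝ) (V : ℝ → ℝ → 𝔸) : Prop where
  exists_list : ∃ L, IsExpProductFormula I L V ∧ ∀ p ∈ L, ∀ t ∈ I, p.1 t ∈ skewAdjoint 𝔸
  star_eq : ∀ t ∈ I, ∀ s ∈ I, star (V t s) = V s t

namespace IsSymmetricProductFormula

variable [CompleteSpace 𝔸] {I : Set ℝ} (hI : Convex ℝ I) {V : ℝ → ℝ → 𝔸}
  (hV : IsSymmetricProductFormula I V)
include hI hV

lemma star_mul_self {s t : ℝ} (hs : s ∈ I) (ht : t ∈ I) : star (V t s) * V t s = 1 := by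
  obtain ⟨L, hL, hskew⟩ := hV.exists_list
  rw [hL.eq_expProduct t ht s hs]
  exact Unitary.star_mul_self_of_mem (expProduct_mem_unitary hI hL.mem_Icc hskew hs ht)

lemma swap_mul_self {s t : ℝ} (hs : s ∈ I) (ht : t ∈ I) : V s t * V t s = 1 := by
  rw [← hV.star_eq t ht s hs, hV.star_mul_self hI hs ht]

variable {s : ℝ} (hs : s ∈ I)
include hs

lemma eventually_star_composition_mul_self (k : ℕ) :
    ∀ᶠ δ in increments I s, star (composition V k s δ) * composition V k s δ = 1 := by
  induction k with
  | zero => exact .of_forall fun δ => by rw [composition_zero, star_one, one_mul]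
  | succ k ih =>
    filter_upwards [ih, eventually_add_mul_mem hI hs k.cast_nonneg,
      eventually_add_mul_mem hI hs (add_nonneg k.cast_nonneg zero_le_one)] with δ hk hδ hδ'
    rw [composition_succ, star_mul, mul_assoc, ← mul_assoc (star (V _ _)),
      hV.star_mul_self hI hδ hδ', one_mul, hk]

lemma starSeries_linearSeries_globalSeries {L : List ((ℝ → 𝔸) × ℝ)}
    (hL : IsExpProductFormula I L V) (hnt : I.Nontrivial) :
    starSeries (linearSeries (globalSeries (formulaSeries L I s)))
      + linearSeries (globalSeries (formulaSeries L I s)) = 0 := by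
  have := increments_neBot hI hs hnt
  refine starSeries_linearSeries_add_linearSeries (evalSeries_zero_globalSeries _) fun k => ?_
  have hexp := hL.hasExpansion_composition hI hs k
  exact HasExpansion.unique increments_le_nhds ((hexp.star.mul increments_le_nhds hexp).congr
    (hV.eventually_star_composition_mul_self hI hs k)) HasExpansion.one

end IsSymmetricProductFormula

end Unitarity

section Midpoint

open Set

variable {𝔸 : Type*} [NormedRing 𝔸] [NormedAlgebra ℝ 𝔸] {I : Set ℝ} {A : ℝ → 𝔸}

lemma isExpProductFormula_midpoint (hA : ContDiffOn ℝ ∞ A I) :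
    IsExpProductFormula I [(A, 1 / 2)] (expProduct [(A, 1 / 2)]) where
  contDiffOn p hp := by rwa [List.mem_singleton.1 hp]
  mem_Icc p hp := by
    rw [List.mem_singleton.1 hp]
    norm_num
  eq_expProduct _ _ _ _ := rfl

lemma isSymmetricProductFormula_midpoint [StarRing 𝔸] [NormedStarGroup 𝔸] [StarModule ℝ 𝔸]
    (hI : Convex ℝ I) (hA : ContDiffOn ℝ ∞ A I) (hskew : ∀ t ∈ I, A t ∈ skewAdjoint 𝔸) :
    IsSymmetricProductFormula I (expProduct [(A, 1 / 2)]) where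
  exists_list := ⟨_, isExpProductFormula_midpoint hA, fun p hp => by
    rwa [List.mem_singleton.1 hp]⟩
  star_eq t ht s hs := by
    have hhalf : (1 / 2 : ℝ) ∈ Icc (0 : ℝ) 1 := by norm_num
    have hstar := skewAdjoint.mem_iff.1 (hskew _ (hI.add_smul_sub_mem hs ht hhalf))
    rw [smul_eq_mul] at hstar
    simp only [expProduct, List.map_singleton, List.prod_singleton]
    rw [NormedSpace.star_exp, star_smul, star_trivial, hstar, smul_neg, ← neg_smul, neg_sub,
      show t + 1 / 2 * (s - t) = s + 1 / 2 * (t - s) by ring]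

end Midpoint

section Matrix

open Asymptotics

lemma neg_I_smul_mem_skewAdjoint {n : Type*} {B : Matrix n n ℂ} (hB : B.IsHermitian) :
    -Complex.I • B ∈ skewAdjoint (Matrix n n ℂ) := by
  rw [skewAdjoint.mem_iff, star_smul, Matrix.star_eq_conjTranspose, hB.eq, ← neg_smul]
  simp

lemma isHermitian_I_smul {n : Type*} {B : Matrix n n ℂ} (hB : B ∈ skewAdjoint (Matrix n n ℂ)) :
    (Complex.I • B).IsHermitian := by
  rw [Matrix.IsHermitian, ← Matrix.star_eq_conjTranspose, star_smul, skewAdjoint.mem_iff.1 hB]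
  simp

variable {ι : Type*} [Fintype ι] [DecidableEq ι] {I : Set ℝ}

lemma IsPropagator.isEvolution {H : ℝ → Matrix ι ι ℂ} {U : ℝ → ℝ → Matrix ι ι ℂ}
    (hU : IsPropagator I H U) : IsEvolution I (fun t => -Complex.I • H t) U :=
  fun s hs => ⟨(hU s hs).1, fun t ht => by
    rw [smul_mul_assoc]
    exact (hU s hs).2 t ht⟩

lemma stepExp_eq_exp (G : ℝ → Matrix ι ι ℂ) (θ t s : ℝ) :
    stepExp G θ t s = NormedSpace.exp ((t - s) • (-Complex.I • G (s + θ * (t - s)))) := by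
  rw [stepExp, mul_smul, smul_comm, Complex.coe_smul]

lemma prod_stepExp_eq_expProduct (L : List ((ℝ → Matrix ι ι ℂ) × ℝ)) (t s : ℝ) :
    (L.map fun p => stepExp p.1 p.2 t s).prod =
      expProduct (L.map fun p => (fun τ => -Complex.I • p.1 τ, p.2)) t s := by
  simp only [expProduct, List.map_map, stepExp_eq_exp]
  rfl

lemma midpointFormula_eq_expProduct (H : ℝ → Matrix ι ι ℂ) :
    midpointFormula H = expProduct [(fun t => -Complex.I • H t, 1 / 2)] := by
  ext1 t
  ext1 s
  rw [midpointFormula, mul_smul, smul_comm, Complex.coe_smul, expProduct, List.map_singleton,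
    List.prod_singleton, show s + 1 / 2 * (t - s) = (s + t) / 2 by ring]

lemma isProductFormula_iff {V : ℝ → ℝ → Matrix ι ι ℂ} : IsProductFormula I V ↔
    ∃ L, IsExpProductFormula I L V ∧ ∀ p ∈ L, ∀ t ∈ I, p.1 t ∈ skewAdjoint (Matrix ι ι ℂ) := by
  constructor
  · rintro ⟨L, hL, hV⟩
    refine ⟨L.map fun p => (fun τ => -Complex.I • p.1 τ, p.2), ⟨?_, ?_, fun t ht s hs => ?_⟩, ?_⟩
    · exact List.forall_mem_map.2 fun p hp => (hL p hp).1.const_smul _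
    · exact List.forall_mem_map.2 fun p hp => (hL p hp).2.2
    · rw [hV t ht s hs, prod_stepExp_eq_expProduct]
    · exact List.forall_mem_map.2 fun p hp t ht => neg_I_smul_mem_skewAdjoint ((hL p hp).2.1 t ht)
  · rintro ⟨L, hL, hskew⟩
    refine ⟨L.map fun p => (fun τ => Complex.I • p.1 τ, p.2), ?_, fun t ht s hs => ?_⟩
    · exact List.forall_mem_map.2 fun p hp => ⟨(hL.contDiffOn p hp).const_smul _,
        fun t ht => isHermitian_I_smul (hskew p hp t ht), hL.mem_Icc p hp⟩
    · rw [hL.eq_expProduct t ht s hs, prod_stepExp_eq_expProduct, List.map_map]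
      simp [Function.comp_def, smul_smul]

lemma isOrderFormula_iff_hasOrder {n : ℕ} {U V : ℝ → ℝ → Matrix ι ι ℂ} :
    IsOrderFormula n I U V ↔ HasOrder n I U V :=
  forall₂_congr fun _ _ => isBigO_norm_left

lemma isBaseFormula_iff {U V : ℝ → ℝ → Matrix ι ι ℂ} : IsBaseFormula I U V ↔
    IsSymmetricProductFormula I V ∧ HasOrder 2 I U V :=
  ⟨fun h => ⟨⟨isProductFormula_iff.1 h.1, h.2⟩, isOrderFormula_iff_hasOrder.1 h.3⟩,
    fun h => ⟨isProductFormula_iff.2 h.1.1, h.1.2, isOrderFormula_iff_hasOrder.2 h.2⟩⟩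

lemma iterate_eq_composition (V : ℝ → ℝ → Matrix ι ι ℂ) (k : ℕ) (t s : ℝ) :
    iterate V k t s = composition V k s ((k : ℝ)⁻¹ * (t - s)) := by
  refine congrArg (fun L => (List.reverse L).prod) (List.map_congr_left fun q _ => ?_)
  push_cast
  congr 1 <;> ring

lemma multiproduct_eq_extrapolation {M : ℕ} (a : Fin M → ℝ) (k : Fin M → ℕ)
    (V : ℝ → ℝ → Matrix ι ι ℂ) : multiproduct a k V = extrapolation a k V := by
  ext1 t
  ext1 s
  simp only [multiproduct, extrapolation, iterate_eq_composition, Complex.coe_smul]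

end Matrix

end Multiproduct

open Multiproduct in
theorem mainTheorem8_general {𝔸 : Type*} [NormedRing 𝔸] [NormedAlgebra ℝ 𝔸] [CompleteSpace 𝔸]
    [StarRing 𝔸] [NormedStarGroup 𝔸] [StarModule ℝ 𝔸] {I : Set ℝ} (hI : Convex ℝ I)
    (hnt : I.Nontrivial) {A : ℝ → 𝔸} (hA : ContDiffOn ℝ ∞ A I)
    (hskew : ∀ t ∈ I, A t ∈ skewAdjoint 𝔸) {U : ℝ → ℝ → 𝔸} (hU : IsEvolution I A U)
    {σ : Type*} [Fintype σ] {M : ℕ} (hM : 1 ≤ M) {a : σ → ℝ} {k : σ → ℕ} (hk : ∀ j, 1 ≤ k j)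
    (hak : ∀ l < M, ∑ j, a j * ((k j : ℝ) ^ (2 * l))⁻¹ = if l = 0 then 1 else 0) :
    (IsSymmetricProductFormula I (expProduct [(A, 1 / 2)]) ∧
      HasOrder 2 I U (expProduct [(A, 1 / 2)])) ∧
    ∀ V : ℝ → ℝ → 𝔸, IsSymmetricProductFormula I V → HasOrder 1 I U V →
      HasOrder (2 * M) I U (extrapolation a k V) ∧
      ∀ s ∈ I, (fun t => star (extrapolation a k V t s) * extrapolation a k V t s - 1)
        =O[𝓝[I] s] fun t => (t - s) ^ (2 * M + 2) := by
  have hmid := isSymmetricProductFormula_midpoint hI hA hskew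
  refine ⟨⟨hmid, (isExpProductFormula_midpoint hA).hasOrder_two hI hU hnt
    (fun t ht s hs => hmid.swap_mul_self hI hs ht) fun t _ => by simp⟩, fun V hV hUV => ?_⟩
  obtain ⟨L, hL, -⟩ := hV.exists_list
  have hinv : ∀ t ∈ I, ∀ s ∈ I, V s t * V t s = 1 := fun t ht s hs => hV.swap_mul_self hI hs ht
  have hLA : ∀ t ∈ I, (L.map fun p => p.1 t).sum = A t := fun t ht =>
    hL.sum_generators_eq hI ht hU hnt hA hUV
  refine ⟨hL.hasOrder_extrapolation hI hU hnt hinv hLA hM hk hak, fun s hs => ?_⟩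
  rw [isBigO_nhdsWithin_iff_increments]
  simp only [add_sub_cancel_left]
  refine star_mul_self_sub_one_isBigO increments_le_nhds ?_ ?_ ?_
    (hL.extrapolation_sub_sub_isBigO hI hs hU hnt hinv hLA hM hk hak)
  · filter_upwards [tendsto_add_increments.eventually self_mem_nhdsWithin] with h hh
    exact hU.star_mul_self hI hskew hs hh
  · exact hU.sub_one_isBigO hs
  · rw [star_smul, star_trivial, ← smul_add, ← coeff_starSeries, ← map_add,
      hV.starSeries_linearSeries_globalSeries hI hs hL hnt, map_zero, smul_zero]

theorem mainTheorem8 {ι : Type*} [Fintype ι] [DecidableEq ι]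
    (α β : ℝ) (hαβ : α < β)
    (H : ℝ → Matrix ι ι ℂ) (hH : ContDiffOn ℝ ∞ H (Set.Icc α β))
    (hHerm : ∀ t ∈ Set.Icc α β, (H t).IsHermitian)
    (U : ℝ → ℝ → Matrix ι ι ℂ) (hU : Multiproduct.IsPropagator (Set.Icc α β) H U)
    (M : ℕ) (hM : 1 ≤ M) (a : Fin M → ℝ) (k : Fin M → ℕ) (hk : ∀ j, 1 ≤ k j)
    (hak : Multiproduct.VandermondeSystem a k) :
    Multiproduct.IsBaseFormula (Set.Icc α β) U (Multiproduct.midpointFormula H) ∧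
    ∀ U₂ : ℝ → ℝ → Matrix ι ι ℂ, Multiproduct.IsBaseFormula (Set.Icc α β) U U₂ →
      Multiproduct.IsOrderFormula (2 * M) (Set.Icc α β) U (Multiproduct.multiproduct a k U₂) ∧
      ∀ t₀ ∈ Set.Icc α β,
        (fun t => ‖(Multiproduct.multiproduct a k U₂ t t₀)ᴴ * Multiproduct.multiproduct a k U₂ t t₀
            - 1‖) =O[𝓝[Set.Icc α β] t₀] fun t => (t - t₀) ^ (2 * M + 2) := by
  obtain ⟨hmid, hmulti⟩ := mainTheorem8_general (convex_Icc α β)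
    ⟨α, Set.left_mem_Icc.2 hαβ.le, β, Set.right_mem_Icc.2 hαβ.le, hαβ.ne⟩
    (hH.const_smul (-Complex.I)) (fun t ht => Multiproduct.neg_I_smul_mem_skewAdjoint (hHerm t ht))
    hU.isEvolution hM hk hak
  simp only [Multiproduct.isBaseFormula_iff, Multiproduct.isOrderFormula_iff_hasOrder,
    Multiproduct.midpointFormula_eq_expProduct, Multiproduct.multiproduct_eq_extrapolation,
    ← Matrix.star_eq_conjTranspose, Asymptotics.isBigO_norm_left]
  exact ⟨hmid, fun U₂ hU₂ => hmulti U₂ hU₂.1 (hU₂.2.mono one_le_two)⟩
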